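/- Let $\mathbb{F}_q$ be the finite field with $q$ elements, let $k\le n$, $r\ge 1$ and $d\ge 2$ be integers, and put $u=n-k-r$. For $t\ge 1$ and $\mathbf X_1,\dots,\mathbf X_d\in\mathbb{F}_q^{(n-k)\times r}$ let $\mathbf M_t$ be the expanded-syndrome matrix of size $t(n-k)\times r(d+t-1)$ $$\mathbf M_t=\begin{pmatrix}\mathbf X_1&\mathbf X_2&\cdots&\mathbf X_d&\mathbf 0&\cdots&\mathbf 0\\ \mathbf 0&\mathbf X_1&\mathbf X_2&\cdots&\mathbf X_d&\cdots&\mathbf 0\\ \vdots&\ddots&\ddots&\ddots&&\ddots&\vdots\\ \mathbf 0&\cdots&\mathbf 0&\mathbf X_1&\mathbf X_2&\cdots&\mathbf X_d\end{pmatrix},$$ and let $P_t$ be the probability that $\mathbf M_t$ has full column rank $r(d+t-1)$ when $\mathbf X_1,\dots,\mathbf X_d$ are independent and uniformly distributed. Then, for $t=r(d-1)$, $$P_t=\prod_{j=0}^{r-1}\bigl(1-q^{j-(n-k)}\bigr)\prod_{j=1}^{r}\bigl(1-q^{j-(n-k)}\bigr),$$ and $$1-\frac{q+1}{q-1}q^{-u}\le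 P_t\le 1-\frac{q+1}{q}q^{-u}+q^{-2u-1}.$$ Moreover, assume $u\ge 0$, let $\mathbf Z$ be uniform in $\mathbb{F}_q^{u\times r(d-1)}$, let $\mathbf A_1,\dots,\mathbf A_{d-1}$ be uniform in $\mathbb{F}_q^{r\times r}$, all independent, let $$\mathbf A=\begin{pmatrix}\mathbf A_1&\mathbf A_2&\cdots&\mathbf A_{d-2}&\mathbf A_{d-1}\\ \mathbf I_r&\mathbf 0&\cdots&\mathbf 0&\mathbf 0\\ \mathbf 0&\mathbf I_r&\ddots&\vdots&\vdots\\ \vdots&\ddots&\ddots&\mathbf 0&\mathbf 0\\ \mathbf 0&\cdots&\mathbf 0&\mathbf I_r&\mathbf 0\end{pmatrix},$$ and let $Q_t$ be the probability that the matrix obtained by stacking $\mathbf Z,\mathbf{ZA},\dots,\mathbf{ZA}^{t-1}$ has rank $r(d-1)$. Then $$Q_{r(d-1)}=\prod_{j=1}^{r}\bigl(1-q^{j-(n-k)}\bigr)\le 1-q^{-u},$$ and, if $u\ge 1$, $$\frac{H_q((d-1)r+u-1)}{H_q(u-1)}\le Q_{r(d-1)},\qquad\text{where } H_q(n)=\prod_{i=1}^{n}(1-q^{-i}).$$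 (The two bounds on $Q_{r(d-1)}$ are the Franch–Li conjecture.) -/

import Mathlib

/-- The probability of the event `s` under the uniform distribution on the finite nonempty
type `Ω`. On a product type, the uniform distribution makes the components independent and
uniformly distributed. -/
noncomputable def uniformProb (Ω : Type*) [Fintype Ω] [Nonempty Ω] (s : Set Ω) : ℝ :=
  ((PMF.uniformOfFintype Ω).toOuterMeasure s).toReal

/-- The expanded-syndrome matrix `M_t`: `t` block rows and `d + t - 1` block columns, with blocks
of size `N × r`. Block row `i` is `0, …, 0, X₁, X₂, …, X_d, 0, …, 0` with `i` leading zero blocks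
(`i` counted from `0`; `X v` is the block `X_{v+1}`). -/
def expandedSyndromeMatrix {F : Type*} [Field F] {N r d : ℕ} (t : ℕ)
    (X : Fin d → Matrix (Fin N) (Fin r) F) :
    Matrix (Fin t × Fin N) (Fin (d + t - 1) × Fin r) F :=
  Matrix.of fun i j =>
    if h : i.1.val ≤ j.1.val ∧ j.1.val - i.1.val < d then
      X ⟨j.1.val - i.1.val, h.2⟩ i.2 j.2
    else 0

/-- `P_t`: the probability that `M_t` has full column rank `r (d + t - 1)` when `X₁, …, X_d` are
independent and uniform in `F^{N × r}`. -/
noncomputable def probFullRank (F : Type*) [Field F] [Fintype F] (N r d t : ℕ) : ℝ :=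
  uniformProb (Fin d → Matrix (Fin N) (Fin r) F)
    {X | (expandedSyndromeMatrix t X).rank = r * (d + t - 1)}

/-- The block companion matrix with `s × s` blocks of size `r × r`: the first block row is
`A₁, …, A_s`, the blocks just below the diagonal are identity matrices, all others are zero. -/
def blockCompanion {F : Type*} [Field F] {s r : ℕ} (A : Fin s → Matrix (Fin r) (Fin r) F) :
    Matrix (Fin s × Fin r) (Fin s × Fin r) F :=
  Matrix.of fun i j =>
    if i.1.val = 0 then A j.1 i.2 j.2
    else if i.1.val = j.1.val + 1 then (1 : Matrix (Fin r) (Fin r) F) i.2 j.2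
    else 0

/-- The matrix `M_t(Z, A)` obtained by stacking `Z, Z A, …, Z A^{t-1}`. -/
def stackedPowers {F ι κ : Type*} [Field F] [Fintype κ] [DecidableEq κ] (t : ℕ)
    (Z : Matrix ι κ F) (A : Matrix κ κ F) : Matrix (Fin t × ι) κ F :=
  Matrix.of fun i j => (Z * A ^ i.1.val) i.2 j

/-- `Q_t`: the probability that `M_t(Z, A)` has rank `r (d - 1)` when `Z` is uniform in
`F^{u × r (d - 1)}` and, independently, `A` is the block companion matrix of independent uniform
`A₁, …, A_{d-1}` in `F^{r × r}`. -/
noncomputable def probStackedFullRank (F : Type*) [Field F] [Fintype F] (u r d t : ℕ) : ℝ :=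
  uniformProb
    (Matrix (Fin u) (Fin (d - 1) × Fin r) F × (Fin (d - 1) → Matrix (Fin r) (Fin r) F))
    {ω | (stackedPowers t ω.1 (blockCompanion ω.2)).rank = r * (d - 1)}

/-- `H_q(n) = ∏_{i=1}^{n} (1 - q^{-i})`. -/
noncomputable def qProd (q : ℝ) (n : ℕ) : ℝ :=
  ∏ i ∈ Finset.Icc 1 n, (1 - q ^ (-(i : ℤ)))

/-! Put `N = n - k`, `d = s + 2`, and read the blocks as a polynomial matrix `X₁ z^(d-1) + X₂
z^(d-2) + ⋯ + X_d`. Both rank conditions become statements about left invertibility over `F[X]`. For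
`M_t` the condition is that `X₁` has independent columns and this matrix has a polynomial left
inverse (`rank_expandedSyndromeMatrix_eq_iff`). For `Q_t` it is left invertibility of a matrix whose
leading coefficient is fixed, an identity above a zero block
(`rank_stackedPowers_blockCompanion_eq_iff`). The bridge is duality: a polynomial matrix is left
invertible exactly when the linear recurrences given by its rows have only the zero solution
(`hasLeftInverse_iff_sequences`). Solutions are the orbits of a block companion matrix of size `r (d
- 1)`, so by Cayley–Hamilton `t = r (d - 1)` steps decide the matter.

It remains to count left invertible matrices with given independent leading columns, one column at a
time (`card_hasLeftInverse_leadPoly`). Let `m` columns `x` with left inverse `φ` be given. A new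
column is uniquely `D • v + (combination of x)` with `D` monic, `v` primitive and `φ v = 0`, and it
extends `x` to a left invertible matrix iff `D = 1`. If `D ≠ 1`, write `D = X * D' + a` with `D'`
monic. The pair `(D', v)` then describes a vector of degree one less, whose leading coefficient is
known modulo the span of the old ones (`HasLeading.exists_mem_leadSet_iff`). So there are `q * q^(s
N + m)` bad columns among `q^((s+1) N)`, a proportion `q^(m+1-N)`, whatever the leading columns are.
Hence `Q_t` is the product of the factors `1 - q^(m+1-N)` for `m < r`, and `P_t` is this times the
probability that `X₁` has independent columns. -/

/-! ### Primitive vectors, column combinations and division of the coefficients -/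

section PolynomialColumns

open Polynomial

variable {F : Type*} [Field F] {ι : Type*}

/-- A vector of polynomials is primitive if its entries generate the unit ideal. -/
def IsPrimitiveVec [Fintype ι] (v : ι → F[X]) : Prop := ∃ ψ : ι → F[X], ψ ⬝ᵥ v = 1

/-- The polynomial columns `x` form a matrix with a polynomial left inverse. -/
def HasLeftInverse [Fintype ι] {m : ℕ} (x : Fin m → ι → F[X]) : Prop :=
  ∃ φ : Fin m → ι → F[X], ∀ a b, φ a ⬝ᵥ x b = if a = b then 1 else 0

theorem exists_monic_smul_primitive [Fintype ι] {v : ι → F[X]} (hv : v ≠ 0) :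
    ∃ D : F[X], ∃ v' : ι → F[X], D.Monic ∧ IsPrimitiveVec v' ∧ v = D • v' := by
  classical
  let I : Ideal F[X] := Ideal.span (Set.range v)
  obtain ⟨g, hg⟩ := (IsPrincipalIdealRing.principal I).principal
  have hmem : ∀ k, v k ∈ Ideal.span {g} := fun k => by
    have : v k ∈ I := Ideal.subset_span ⟨k, rfl⟩
    rw [hg] at this; exact this
  have hg0 : g ≠ 0 := by
    rintro rfl
    apply hv; funext k
    simpa using hmem k
  have hgI : g ∈ I := by rw [hg]; exact Ideal.mem_span_singleton_self g
  obtain ⟨ψ, hψ⟩ := Ideal.mem_span_range_iff_exists_fun.1 hgI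
  have hl : g.leadingCoeff ≠ 0 := leadingCoeff_ne_zero.2 hg0
  choose w hw using fun k => Ideal.mem_span_singleton'.1 (hmem k)
  refine ⟨g * C g.leadingCoeff⁻¹, fun k => C g.leadingCoeff * w k,
    monic_mul_leadingCoeff_inv hg0, ⟨fun k => C g.leadingCoeff⁻¹ * ψ k, ?_⟩, ?_⟩
  · have h1 : C g.leadingCoeff⁻¹ * C g.leadingCoeff = (1 : F[X]) := by
      rw [← C_mul, inv_mul_cancel₀ hl, C_1]
    apply mul_left_cancel₀ hg0
    rw [mul_one]
    conv_rhs => rw [← hψ]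
    simp only [dotProduct, Finset.mul_sum]
    refine Finset.sum_congr rfl fun k _ => ?_
    rw [← hw k]
    linear_combination (g * ψ k * w k) * h1
  · funext k
    have h1 : C g.leadingCoeff⁻¹ * C g.leadingCoeff = (1 : F[X]) := by
      rw [← C_mul, inv_mul_cancel₀ hl, C_1]
    simp only [Pi.smul_apply, smul_eq_mul]
    rw [← hw k]
    linear_combination (-(g * w k)) * h1

theorem monic_smul_primitive_unique [Fintype ι] {D E : F[X]} {v w : ι → F[X]}
    (hD : D.Monic) (hE : E.Monic) (hv : IsPrimitiveVec v) (hw : IsPrimitiveVec w)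
    (h : D • v = E • w) : D = E ∧ v = w := by
  have key : D = E := by
    obtain ⟨ψ, hψ⟩ := hv
    obtain ⟨χ, hχ⟩ := hw
    refine eq_of_monic_of_associated hD hE (associated_of_dvd_dvd ?_ ?_)
    · refine ⟨χ ⬝ᵥ v, ?_⟩
      have := congrArg (fun z => χ ⬝ᵥ z) h
      simp only [dotProduct_smul, hχ, smul_eq_mul, mul_one] at this
      exact this.symm
    · refine ⟨ψ ⬝ᵥ w, ?_⟩
      have := congrArg (fun z => ψ ⬝ᵥ z) h
      simp only [dotProduct_smul, hψ, smul_eq_mul, mul_one] at this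
      exact this
  subst key
  exact ⟨rfl, smul_right_injective _ hD.ne_zero h⟩

/-- The linear combination of the columns `x` with polynomial coefficients `c`. -/
noncomputable def columnComb {m : ℕ} (x : Fin m → ι → F[X]) (c : Fin m → F[X]) : ι → F[X] :=
  ∑ a, c a • x a

theorem columnComb_apply {m : ℕ} (x : Fin m → ι → F[X]) (c : Fin m → F[X]) (k : ι) :
    columnComb x c k = ∑ a, c a * x a k := by
  simp [columnComb]

theorem degree_C_mul_le_degree (a : F) (p : F[X]) : (C a * p).degree ≤ p.degree := by
  rw [← smul_eq_C_mul]
  exact degree_smul_le a p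

theorem monic_X_mul_add_C {D : F[X]} (hD : D.Monic) (a : F) : (X * D + C a).Monic := by
  refine (monic_X.mul hD).add_of_left ?_
  have h : (C a).degree ≤ 0 := degree_C_le
  refine h.trans_lt ?_
  rw [degree_mul, degree_X, degree_eq_natDegree hD.ne_zero]
  exact_mod_cast Nat.lt_of_lt_of_le Nat.zero_lt_one (Nat.le_add_right 1 _)

theorem columnComb_add {m : ℕ} (x : Fin m → ι → F[X]) (c e : Fin m → F[X]) :
    columnComb x (c + e) = columnComb x c + columnComb x e := by
  simp [columnComb, add_smul, Finset.sum_add_distrib]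

theorem columnComb_sub {m : ℕ} (x : Fin m → ι → F[X]) (c e : Fin m → F[X]) :
    columnComb x (c - e) = columnComb x c - columnComb x e := by
  simp [columnComb, sub_smul]

theorem columnComb_smul {m : ℕ} (x : Fin m → ι → F[X]) (D : F[X]) (c : Fin m → F[X]) :
    columnComb x (D • c) = D • columnComb x c := by
  simp [columnComb, mul_smul, Finset.smul_sum]

theorem dotProduct_columnComb [Fintype ι] {m : ℕ} (x : Fin m → ι → F[X]) (c : Fin m → F[X])
    (ψ : ι → F[X]) : ψ ⬝ᵥ columnComb x c = ∑ a, c a * (ψ ⬝ᵥ x a) := by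
  simp [columnComb, dotProduct_sum, dotProduct_smul]

theorem dual_dotProduct_columnComb [Fintype ι] {m : ℕ} {x φ : Fin m → ι → F[X]}
    (hφ : ∀ a b, φ a ⬝ᵥ x b = if a = b then 1 else 0) (c : Fin m → F[X]) (a : Fin m) :
    φ a ⬝ᵥ columnComb x c = c a := by
  simp [dotProduct_columnComb, hφ]

/-- The vectors `x` have degree at most `e`, with linearly independent leading coefficients `L`. -/
structure HasLeading {m : ℕ} (e : ℕ) (L : Fin m → ι → F) (x : Fin m → ι → F[X]) : Prop where
  degree_lt : ∀ a k, (x a k).natDegree ≤ e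
  coeff_eq : ∀ a k, (x a k).coeff e = L a k
  indep : LinearIndependent F L

theorem HasLeading.coeff_columnComb {m e n : ℕ} {L : Fin m → ι → F} {x : Fin m → ι → F[X]}
    (hx : HasLeading e L x) {c : Fin m → F[X]} (hc : ∀ a, (c a).natDegree ≤ n) (k : ι) :
    (columnComb x c k).coeff (n + e) = ∑ a, (c a).coeff n * L a k := by
  rw [columnComb_apply, finsetSum_coeff]
  refine Finset.sum_congr rfl fun a _ => ?_
  rw [coeff_mul_add_eq_of_natDegree_le (hc a) (hx.degree_lt a k), hx.coeff_eq]

/-- Top terms cannot cancel: the highest-degree coefficients of `c` would give a linear relation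
among the `L a`. This makes low-degree representatives modulo the columns unique. -/
theorem HasLeading.eq_zero_of_degree_lt {m e : ℕ} {L : Fin m → ι → F} {x : Fin m → ι → F[X]}
    (hx : HasLeading e L x) {c : Fin m → F[X]} (h : ∀ k, (columnComb x c k).degree < e) :
    c = 0 := by
  have key : ∀ n : ℕ, (∀ a, (c a).degree < n) → c = 0 := by
    intro n
    induction n with
    | zero =>
      intro hn; funext a
      have := hn a
      simpa [degree_eq_bot] using this
    | succ n ih =>
      intro hn
      apply ih
      have hn' : ∀ a, (c a).natDegree ≤ n := fun a =>
        natDegree_le_of_degree_le (by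
          have := hn a
          rw [degree_lt_iff_coeff_zero] at this
          rw [degree_le_iff_coeff_zero]
          intro j hj
          exact this j (by exact_mod_cast hj))
      have h0 : ∑ a, (c a).coeff n • L a = 0 := by
        funext k
        have h1 := hx.coeff_columnComb hn' k
        rw [coeff_eq_zero_of_degree_lt
          ((h k).trans_le (by exact_mod_cast Nat.le_add_left e n))] at h1
        simpa using h1.symm
      have h2 := Fintype.linearIndependent_iff.1 hx.indep _ h0
      intro a
      rw [degree_lt_iff_coeff_zero]
      intro j hj
      rcases eq_or_lt_of_le hj with rfl | hj
      · exact h2 a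
      · exact coeff_eq_zero_of_natDegree_lt ((hn' a).trans_lt hj)
  refine key ((Finset.univ.sup fun a => (c a).natDegree) + 1) fun a => ?_
  refine degree_le_natDegree.trans_lt ?_
  exact_mod_cast Nat.lt_succ_of_le
    (Finset.le_sup (f := fun a => (c a).natDegree) (Finset.mem_univ a))

/-- The vectors of degree at most `e` with leading coefficient `l`. -/
def leadSet (e : ℕ) (l : ι → F) : Set (ι → F[X]) :=
  {y | ∀ k, (y k).degree ≤ e ∧ (y k).coeff e = l k}

/-- The vectors of degree at most `e` with leading coefficient in `l + span L`. -/
def leadCosetSet {m : ℕ} (e : ℕ) (l : ι → F) (L : Fin m → ι → F) : Set (ι → F[X]) :=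
  {w | ∃ b : Fin m → F, w ∈ leadSet e (l + ∑ a, b a • L a)}

/-- Division of the coefficients of the columns by a monic polynomial. -/
theorem HasLeading.exists_reduction {m s : ℕ} {L : Fin m → ι → F} {x : Fin m → ι → F[X]}
    (hx : HasLeading (s + 1) L x) {E : F[X]} (hE : E.Monic) (v : ι → F[X]) (c : Fin m → F[X])
    (h : ∀ k, ((E • v + columnComb x c) k).degree < (s + 1 + E.natDegree : ℕ)) :
    ∃ c₀ c₁ : Fin m → F[X], c = E • c₁ + c₀ ∧
      ∀ k, ((v + columnComb x c₁) k).degree ≤ ((s : ℕ) : WithBot ℕ) := by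
  refine ⟨fun a => c a %ₘ E, fun a => c a /ₘ E, ?_, ?_⟩
  · funext a
    simp only [Pi.add_apply, Pi.smul_apply, smul_eq_mul]
    rw [add_comm, modByMonic_add_div]
  intro k
  set c₀ : Fin m → F[X] := fun a => c a %ₘ E
  set c₁ : Fin m → F[X] := fun a => c a /ₘ E
  have hc : c = E • c₁ + c₀ := by
    funext a
    simp only [Pi.add_apply, Pi.smul_apply, smul_eq_mul, c₀, c₁]
    rw [add_comm, modByMonic_add_div]
  have h0 : (columnComb x c₀ k).degree < (s + 1 + E.natDegree : ℕ) := by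
    rw [columnComb_apply]
    refine (degree_sum_le _ _).trans_lt ?_
    rw [Finset.sup_lt_iff (WithBot.bot_lt_coe _)]
    intro a _
    by_cases hz : c₀ a = 0
    · simp [hz]
    have h1 : (c₀ a).natDegree < E.natDegree := by
      have := degree_modByMonic_lt (c a) hE
      exact natDegree_lt_natDegree hz this
    refine (natDegree_le_iff_degree_le.1 (natDegree_mul_le (p := c₀ a) (q := x a k))).trans_lt ?_
    have h2 := hx.degree_lt a k
    exact_mod_cast (by omega : (c₀ a).natDegree + (x a k).natDegree < s + 1 + E.natDegree)
  -- Both terms on the right have degree below `s + 1 + deg E`, so cancelling `E` leaves degree at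
  -- most `s`.
  have h3 : E * (v + columnComb x c₁) k = (E • v + columnComb x c) k - columnComb x c₀ k := by
    rw [hc, columnComb_add, columnComb_smul]
    simp only [Pi.add_apply, Pi.smul_apply, smul_eq_mul]
    ring
  have h4 : (E * (v + columnComb x c₁) k).degree < (s + 1 + E.natDegree : ℕ) := by
    rw [h3]
    exact (degree_sub_le _ _).trans_lt (max_lt (h k) h0)
  by_cases hz : (v + columnComb x c₁) k = 0
  · rw [hz]; simp
  rw [degree_mul, degree_eq_natDegree hE.ne_zero, degree_eq_natDegree hz] at h4
  rw [degree_eq_natDegree hz]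
  have : E.natDegree + ((v + columnComb x c₁) k).natDegree < s + 1 + E.natDegree := by
    exact_mod_cast h4
  exact_mod_cast (by omega : ((v + columnComb x c₁) k).natDegree ≤ s)

/-- Reducing coefficients turns `v` into a representative `y₂` of degree at most `s`. Members `y`
and `w` of the classes of `(X * D + C a) • v` and `D • v` are then related by `y = X w + a y₂ +` a
constant combination of `x`. The term `a y₂` does not reach degree `s + 1`, and the constant
combination moves the leading coefficient within the span of `L`; this is why a coset appears on the
lower level. -/
theorem HasLeading.exists_mem_leadSet_iff {m s : ℕ} {L : Fin m → ι → F} {x : Fin m → ι → F[X]}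
    (hx : HasLeading (s + 1) L x) {D : F[X]} (hD : D.Monic) (a : F) (v : ι → F[X])
    (l : ι → F) :
    (∃ c, (X * D + C a) • v + columnComb x c ∈ leadSet (s + 1) l) ↔
      ∃ c, D • v + columnComb x c ∈ leadCosetSet s l L := by
  have coeffC : ∀ (b : Fin m → F) (k : ι),
      (columnComb x (fun i => C (b i)) k).coeff (s + 1) = ∑ i, b i * L i k := by
    intro b k
    have := hx.coeff_columnComb (n := 0) (c := fun i => C (b i)) (fun i => by simp) k
    simpa using this
  have degC : ∀ (b : Fin m → F) (k : ι),
      (columnComb x (fun i => C (b i)) k).degree ≤ ((s + 1 : ℕ) : WithBot ℕ) := by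
    intro b k
    rw [columnComb_apply]
    refine (degree_sum_le _ _).trans (Finset.sup_le fun i _ => ?_)
    refine (degree_C_mul_le_degree _ _).trans ?_
    exact natDegree_le_iff_degree_le.1 (hx.degree_lt i k)
  constructor
  · rintro ⟨c, hc⟩
    have hnd : (X * D + C a).natDegree = D.natDegree + 1 := by
      rw [natDegree_add_C, natDegree_X_mul hD.ne_zero]
    have hE := monic_X_mul_add_C hD a
    obtain ⟨c₀, c₁, hcc, hdeg⟩ := hx.exists_reduction hE v c (fun k =>
      (hc k).1.trans_lt (by exact_mod_cast (by omega)))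
    set y₂ := v + columnComb x c₁ with hy₂
    -- Substitute `c = (X * D + C a) • c₁ + c₀` and split `c₀` into a multiple of `X` and a
    -- constant; collecting the multiples of `X` gives this `w`.
    refine ⟨D • c₁ + fun i => (c₀ i).divX, -fun i => (c₀ i).coeff 0, fun k => ?_⟩
    set w := D • v + columnComb x (D • c₁ + fun i => (c₀ i).divX) with hw
    have hc₀ : c₀ = (X : F[X]) • (fun i => (c₀ i).divX) + fun i => C ((c₀ i).coeff 0) := by
      funext i
      simp only [Pi.add_apply, Pi.smul_apply, smul_eq_mul]
      exact (X_mul_divX_add _).symm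
    have hXw : X * w k = ((X * D + C a) • v + columnComb x c) k - C a * y₂ k
        - columnComb x (fun i => C ((c₀ i).coeff 0)) k := by
      have e1 : columnComb x c = (X * D + C a) • columnComb x c₁ +
          ((X : F[X]) • columnComb x (fun i => (c₀ i).divX) +
            columnComb x fun i => C ((c₀ i).coeff 0)) := by
        rw [hcc, columnComb_add, columnComb_smul]
        conv_lhs => rw [hc₀]
        rw [columnComb_add, columnComb_smul]
      rw [e1, hw, hy₂, columnComb_add, columnComb_smul]
      simp only [Pi.add_apply, Pi.smul_apply, smul_eq_mul]
      ring
    have hy₂k : (C a * y₂ k).degree ≤ ((s : ℕ) : WithBot ℕ) :=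
      (degree_C_mul_le_degree _ _).trans (hdeg k)
    have hdX : (X * w k).degree ≤ ((s + 1 : ℕ) : WithBot ℕ) := by
      rw [hXw]
      refine (degree_sub_le _ _).trans (max_le ((degree_sub_le _ _).trans (max_le (hc k).1 ?_))
        (degC _ k))
      exact hy₂k.trans (by exact_mod_cast Nat.le_succ s)
    constructor
    · rw [degree_le_iff_coeff_zero] at hdX ⊢
      intro j hj
      have := hdX (j + 1) (by exact_mod_cast Nat.succ_lt_succ (by exact_mod_cast hj))
      rwa [coeff_X_mul] at this
    · rw [← coeff_X_mul, hXw, coeff_sub, coeff_sub, (hc k).2, coeffC,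
        coeff_eq_zero_of_degree_lt (hy₂k.trans_lt (by exact_mod_cast Nat.lt_succ_self s))]
      simp [Finset.sum_neg_distrib, sub_eq_add_neg]
  · rintro ⟨c, b, hc⟩
    obtain ⟨c₀, c₁, hcc, hdeg⟩ := hx.exists_reduction hD v c (fun k =>
      (hc k).1.trans_lt (by exact_mod_cast (by omega)))
    set w := D • v + columnComb x c with hw
    set y₂ := v + columnComb x c₁ with hy₂
    refine ⟨(X : F[X]) • c + C a • c₁ - fun i => C (b i), fun k => ?_⟩
    have e1 : ((X * D + C a) • v + columnComb x ((X : F[X]) • c + C a • c₁ - fun i => C (b i))) k =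
        X * w k + C a * y₂ k - columnComb x (fun i => C (b i)) k := by
      rw [columnComb_sub, columnComb_add, columnComb_smul, columnComb_smul]
      simp only [hw, hy₂, Pi.add_apply, Pi.sub_apply, Pi.smul_apply, smul_eq_mul]
      ring
    have hy₂k : (C a * y₂ k).degree ≤ ((s : ℕ) : WithBot ℕ) :=
      (degree_C_mul_le_degree _ _).trans (hdeg k)
    rw [e1]
    constructor
    · refine (degree_sub_le _ _).trans (max_le ((degree_add_le _ _).trans (max_le ?_ ?_))
        (degC _ k))
      · rw [degree_le_iff_coeff_zero]
        intro j hj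
        have hj' : s + 1 < j := by exact_mod_cast hj
        obtain ⟨j, rfl⟩ : ∃ i, j = i + 1 := ⟨j - 1, by omega⟩
        rw [coeff_X_mul]
        exact coeff_eq_zero_of_degree_lt ((hc k).1.trans_lt (by exact_mod_cast (by omega)))
      · exact hy₂k.trans (by exact_mod_cast Nat.le_succ s)
    · rw [coeff_sub, coeff_add, coeff_X_mul, (hc k).2, coeffC,
        coeff_eq_zero_of_degree_lt (hy₂k.trans_lt (by exact_mod_cast Nat.lt_succ_self s))]
      simp

end PolynomialColumns

/-! ### Content of a new column and the degree-lowering bijection -/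

section PolynomialColumns

open Polynomial

variable {F : Type*} [Field F] {ι : Type*} [Fintype ι]

/-- The pairs `(D, v)` with `D` monic and `v` primitive in the kernel of `φ` such that the class
of `D • v` modulo the columns `x` meets `S`. -/
def contentPairs {m : ℕ} (x φ : Fin m → ι → F[X]) (S : Set (ι → F[X])) :
    Set (F[X] × (ι → F[X])) :=
  {p | p.1.Monic ∧ IsPrimitiveVec p.2 ∧ (∀ a, φ a ⬝ᵥ p.2 = 0) ∧
    ∃ c, p.1 • p.2 + columnComb x c ∈ S}

theorem exists_content_decomposition {m : ℕ} {x φ : Fin m → ι → F[X]}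
    (hφ : ∀ a b, φ a ⬝ᵥ x b = if a = b then 1 else 0) {y : ι → F[X]}
    (hy : ∀ c, y ≠ columnComb x c) :
    ∃ (D : F[X]) (v : ι → F[X]) (c : Fin m → F[X]), D.Monic ∧
        IsPrimitiveVec v ∧ (∀ a, φ a ⬝ᵥ v = 0) ∧ y = D • v + columnComb x c := by
  obtain ⟨D, v, hD, hv, h⟩ := exists_monic_smul_primitive
    (sub_ne_zero.2 (hy fun a => φ a ⬝ᵥ y))
  refine ⟨D, v, fun a => φ a ⬝ᵥ y, hD, hv, fun a => ?_, by rw [← h, sub_add_cancel]⟩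
  have := congrArg (fun z => φ a ⬝ᵥ z) h
  simp only [dotProduct_sub, dual_dotProduct_columnComb hφ, sub_self, dotProduct_smul,
    smul_eq_mul] at this
  exact (mul_eq_zero.1 this.symm).resolve_left hD.ne_zero

theorem content_decomposition_unique {m : ℕ} {x φ : Fin m → ι → F[X]}
    (hφ : ∀ a b, φ a ⬝ᵥ x b = if a = b then 1 else 0) {D E : F[X]} {v w : ι → F[X]}
    {c e : Fin m → F[X]} (hD : D.Monic) (hE : E.Monic)
    (hv : IsPrimitiveVec v) (hw : IsPrimitiveVec w) (hφv : ∀ a, φ a ⬝ᵥ v = 0)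
    (hφw : ∀ a, φ a ⬝ᵥ w = 0) (h : D • v + columnComb x c = E • w + columnComb x e) :
    D = E ∧ v = w := by
  have hce : c = e := by
    funext a
    have := congrArg (fun z => φ a ⬝ᵥ z) h
    simpa [dotProduct_add, dual_dotProduct_columnComb hφ, dotProduct_smul, hφv, hφw] using this
  subst hce
  exact monic_smul_primitive_unique hD hE hv hw (add_right_cancel h)

/-- By `hS` the set `S` meets each class modulo the columns at most once, so a pair `(D, v)`
determines its representative in `S`; uniqueness of the decomposition recovers the pair. -/
theorem ncard_contentPairs {m : ℕ} {x φ : Fin m → ι → F[X]}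
    (hφ : ∀ a b, φ a ⬝ᵥ x b = if a = b then 1 else 0) {S : Set (ι → F[X])}
    (hS : ∀ y ∈ S, ∀ y' ∈ S, ∀ c, y - y' = columnComb x c → y = y') (T : F[X] → Prop) :
    {p ∈ contentPairs x φ S | T p.1}.ncard =
      {y ∈ S | ∃ (D : F[X]) (v : ι → F[X]) (c : Fin m → F[X]), D.Monic ∧
        IsPrimitiveVec v ∧ (∀ a, φ a ⬝ᵥ v = 0) ∧
        y = D • v + columnComb x c ∧ T D}.ncard := by
  refine Set.ncard_congr (fun p hp => p.1 • p.2 + columnComb x hp.1.2.2.2.choose) ?_ ?_ ?_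
  · rintro p ⟨⟨hD, hv, hφv, hc⟩, hT⟩
    exact ⟨hc.choose_spec, _, _, _, hD, hv, hφv, rfl, hT⟩
  · rintro p p' ⟨⟨hD, hv, hφv, hc⟩, hT⟩ ⟨⟨hD', hv', hφv', hc'⟩, hT'⟩ h
    obtain ⟨h1, h2⟩ := content_decomposition_unique hφ hD hD' hv hv' hφv hφv' h
    exact Prod.ext h1 h2
  · rintro y ⟨hy, D, v, c, hD, hv, hφv, rfl, hT⟩
    have hc : ∃ c, D • v + columnComb x c ∈ S := ⟨c, hy⟩
    refine ⟨(D, v), ⟨⟨hD, hv, hφv, hc⟩, hT⟩, ?_⟩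
    refine hS _ hc.choose_spec _ hy (hc.choose - c) ?_
    rw [columnComb_sub]
    abel

/-- The row of a left inverse dual to the new column kills `x`, so `D` divides 1. Conversely, a row
`χ` with `χ ⬝ᵥ v = 1` can be corrected by the rows of `φ` to kill `x`, and then the rows of `φ` by
it. -/
theorem hasLeftInverse_cons_iff {m : ℕ} {x φ : Fin m → ι → F[X]}
    (hφ : ∀ a b, φ a ⬝ᵥ x b = if a = b then 1 else 0) {D : F[X]} {v : ι → F[X]}
    {c : Fin m → F[X]} (hD : D.Monic) (hv : IsPrimitiveVec v) (hφv : ∀ a, φ a ⬝ᵥ v = 0) :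
    HasLeftInverse (Fin.cons (D • v + columnComb x c) x : Fin (m + 1) → ι → F[X]) ↔ D = 1 := by
  constructor
  · rintro ⟨ψ, hψ⟩
    have h0 := hψ 0 0
    have h1 : ∀ a, ψ 0 ⬝ᵥ x a = 0 := fun a => by
      simpa [(Fin.succ_ne_zero a).symm] using hψ 0 a.succ
    simp only [Fin.cons_zero, dotProduct_add, dotProduct_smul, dotProduct_columnComb, h1,
      mul_zero, Finset.sum_const_zero, add_zero, if_true, smul_eq_mul] at h0
    exact hD.eq_one_of_isUnit (IsUnit.of_mul_eq_one _ h0)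
  · rintro rfl
    obtain ⟨χ, hχ⟩ := hv
    let ψ : ι → F[X] := χ - columnComb φ fun a => χ ⬝ᵥ x a
    have hψx : ∀ b, ψ ⬝ᵥ x b = 0 := fun b => by
      rw [sub_dotProduct, columnComb, sum_dotProduct]
      simp [smul_dotProduct, hφ]
    have hψv : ψ ⬝ᵥ v = 1 := by
      rw [sub_dotProduct, columnComb, sum_dotProduct]
      simp [smul_dotProduct, hφv, hχ]
    have hψy : ψ ⬝ᵥ ((1 : F[X]) • v + columnComb x c) = 1 := by
      simp [dotProduct_add, dotProduct_columnComb, hψx, hψv]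
    refine ⟨Fin.cons ψ fun a => φ a - c a • ψ, fun a b => ?_⟩
    refine Fin.cases ?_ (fun a => ?_) a <;> refine Fin.cases ?_ (fun b => ?_) b
    · simpa using hψy
    · simp [hψx, (Fin.succ_ne_zero b).symm]
    · rw [Fin.cons_succ, Fin.cons_zero, sub_dotProduct, smul_dotProduct, hψy, dotProduct_add,
        dual_dotProduct_columnComb hφ, dotProduct_smul, hφv]
      simp [Fin.succ_ne_zero]
    · simp [sub_dotProduct, smul_dotProduct, hψx, hφ]

theorem HasLeftInverse.of_cons {m : ℕ} {x : Fin m → ι → F[X]} {y : ι → F[X]}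
    (h : HasLeftInverse (Fin.cons y x : Fin (m + 1) → ι → F[X])) : HasLeftInverse x := by
  obtain ⟨φ, hφ⟩ := h
  exact ⟨fun a => φ a.succ, fun a b => by simpa using hφ a.succ b.succ⟩

/-- Among the vectors with leading coefficient `l`, those that do not complete the columns `x` to
a left invertible matrix are counted through the vectors of smaller degree. -/
theorem ncard_not_hasLeftInverse_cons {m s : ℕ} {L : Fin m → ι → F} {l : ι → F}
    {x φ : Fin m → ι → F[X]} (hx : HasLeading (s + 1) L x)
    (hφ : ∀ a b, φ a ⬝ᵥ x b = if a = b then 1 else 0)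
    (hl : l ∉ Submodule.span F (Set.range L)) :
    {y ∈ leadSet (s + 1) l |
        ¬ HasLeftInverse (Fin.cons y x : Fin (m + 1) → ι → F[X])}.ncard =
      Nat.card F * (leadCosetSet s l L).ncard := by
  have hlb : ∀ b : Fin m → F, l ≠ ∑ a, b a • L a := by
    rintro b rfl
    exact hl (Submodule.sum_mem _ fun a _ =>
      Submodule.smul_mem _ _ (Submodule.subset_span ⟨a, rfl⟩))
  have hY : ∀ y ∈ leadSet (s + 1) l, ∀ c, y ≠ columnComb x c := by
    rintro y hy c rfl
    -- Proved by contradiction: `y` adjoined to `x` still has independent leading coefficients,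
    -- while `(-1, c)` would be a nontrivial relation.
    have hdeg : ∀ a, (c a).natDegree ≤ 0 := by
      have hx' : HasLeading (s + 1) (Fin.cons l L : Fin (m + 1) → ι → F)
          (Fin.cons (columnComb x c) x : Fin (m + 1) → ι → F[X]) := by
        refine ⟨fun a k => ?_, fun a k => ?_, linearIndependent_finCons.2 ⟨hx.indep, hl⟩⟩
        · refine Fin.cases ?_ (fun a => ?_) a
          · simpa using natDegree_le_of_degree_le (hy k).1
          · simpa using hx.degree_lt a k
        · refine Fin.cases ?_ (fun a => ?_) a
          · simpa using (hy k).2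
          · simpa using hx.coeff_eq a k
      have := hx'.eq_zero_of_degree_lt (c := Fin.cons (-1) c) (fun k => by
        have : columnComb (Fin.cons (columnComb x c) x : Fin (m + 1) → ι → F[X])
            (Fin.cons (-1) c) = 0 := by
          simp [columnComb, Fin.sum_univ_succ]
        rw [this]
        simp)
      have h0 := congrFun this 0
      simp at h0
    have h1 : l = ∑ a, (c a).coeff 0 • L a := by
      funext k
      have h2 := hx.coeff_columnComb hdeg k
      rw [zero_add, (hy k).2] at h2
      simpa using h2
    exact hlb _ h1
  have hW : ∀ w ∈ leadCosetSet s l L, ∀ c, w ≠ columnComb x c := by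
    rintro w ⟨b, hw⟩ c rfl
    have hc := hx.eq_zero_of_degree_lt (c := c) fun k =>
      (hw k).1.trans_lt (by exact_mod_cast Nat.lt_succ_self s)
    apply hlb (-b)
    funext k
    have := (hw k).2
    rw [hc] at this
    simp [columnComb] at this
    simp only [Pi.neg_apply, neg_smul, Finset.sum_neg_distrib, Finset.sum_apply, Pi.smul_apply,
      smul_eq_mul]
    linear_combination -this
  -- Leading terms cancel, so the difference has degree below `s + 1` and cannot be a nonzero
  -- combination of `x`. In `leadCosetSet` the degrees are already that small.
  have hY' : ∀ y ∈ leadSet (s + 1) l, ∀ y' ∈ leadSet (s + 1) l, ∀ c,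
      y - y' = columnComb x c → y = y' := by
    intro y hy y' hy' c h
    have hc := hx.eq_zero_of_degree_lt (c := c) fun k => by
      rw [← h, degree_lt_iff_coeff_zero]
      intro j hj
      rcases eq_or_lt_of_le hj with rfl | hj
      · simp [(hy k).2, (hy' k).2]
      · rw [Pi.sub_apply, coeff_sub,
          coeff_eq_zero_of_degree_lt ((hy k).1.trans_lt (by exact_mod_cast hj)),
          coeff_eq_zero_of_degree_lt ((hy' k).1.trans_lt (by exact_mod_cast hj)), sub_zero]
    rw [hc] at h
    simpa [columnComb, sub_eq_zero] using h
  have hW' : ∀ y ∈ leadCosetSet s l L, ∀ y' ∈ leadCosetSet s l L, ∀ c,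
      y - y' = columnComb x c → y = y' := by
    rintro y ⟨b, hy⟩ y' ⟨b', hy'⟩ c h
    have hc := hx.eq_zero_of_degree_lt (c := c) fun k => by
      rw [← h]
      refine (degree_sub_le _ _).trans_lt
        (max_lt ((hy k).1.trans_lt ?_) ((hy' k).1.trans_lt ?_)) <;>
      exact_mod_cast Nat.lt_succ_self s
    rw [hc] at h
    simpa [columnComb, sub_eq_zero] using h
  have e1 : {y ∈ leadSet (s + 1) l |
        ¬ HasLeftInverse (Fin.cons y x : Fin (m + 1) → ι → F[X])} =
      {y ∈ leadSet (s + 1) l | ∃ (D : F[X]) (v : ι → F[X]) (c : Fin m → F[X]), D.Monic ∧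
        IsPrimitiveVec v ∧ (∀ a, φ a ⬝ᵥ v = 0) ∧
        y = D • v + columnComb x c ∧ D ≠ 1} := by
    ext y
    refine and_congr_right fun hy => ?_
    constructor
    · intro h
      obtain ⟨D, v, c, hD, hv, hφv, rfl⟩ := exists_content_decomposition hφ (hY y hy)
      rw [hasLeftInverse_cons_iff hφ hD hv hφv] at h
      exact ⟨D, v, c, hD, hv, hφv, rfl, h⟩
    · rintro ⟨D, v, c, hD, hv, hφv, rfl, h⟩
      rwa [hasLeftInverse_cons_iff hφ hD hv hφv]
  have e2 : leadCosetSet s l L =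
      {y ∈ leadCosetSet s l L | ∃ (D : F[X]) (v : ι → F[X]) (c : Fin m → F[X]), D.Monic ∧
        IsPrimitiveVec v ∧ (∀ a, φ a ⬝ᵥ v = 0) ∧
        y = D • v + columnComb x c ∧ True} := by
    ext y
    refine ⟨fun hy => ⟨hy, ?_⟩, And.left⟩
    obtain ⟨D, v, c, hD, hv, hφv, rfl⟩ := exists_content_decomposition hφ (hW y hy)
    exact ⟨D, v, c, hD, hv, hφv, rfl, trivial⟩
  rw [e1, e2, ← ncard_contentPairs hφ hY', ← ncard_contentPairs hφ hW', ← Set.ncard_univ F,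
    ← Set.ncard_prod]
  symm
  -- A monic polynomial other than 1 is uniquely `X * D + C a` with `D` monic; the free constant `a`
  -- accounts for the factor `Nat.card F`.
  refine Set.ncard_congr (fun p _ => (X * p.2.1 + C p.1, p.2.2)) ?_ ?_ ?_
  · rintro ⟨a, D, v⟩ ⟨-, ⟨hD, hv, hφv, hc⟩, -⟩
    have hnd : (X * D + C a).natDegree = D.natDegree + 1 := by
      rw [natDegree_add_C, natDegree_X_mul hD.ne_zero]
    refine ⟨⟨monic_X_mul_add_C hD a, hv, hφv, (hx.exists_mem_leadSet_iff hD a v l).2 hc⟩,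
      fun h => ?_⟩
    have h : X * D + C a = 1 := h
    rw [h, natDegree_one] at hnd
    omega
  · rintro ⟨a, D, v⟩ ⟨a', D', v'⟩ - - h
    simp only [Prod.mk.injEq] at h
    have h1 : D = D' := by
      ext n
      have := congrArg (fun p => coeff p (n + 1)) h.1
      simpa [coeff_C_succ] using this
    have h2 : a = a' := by
      have := congrArg (fun p => coeff p 0) h.1
      simpa using this
    rw [h1, h2, h.2]
  · rintro ⟨E, v⟩ ⟨⟨hE, hv, hφv, hc⟩, hE1⟩
    have hdecomp : X * E.divX + C (E.coeff 0) = E := X_mul_divX_add E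
    have hpos : E.natDegree ≠ 0 := fun h => hE1 (hE.natDegree_eq_zero.1 h)
    have hD : E.divX.Monic := by
      rw [Monic, leadingCoeff, natDegree_divX_eq_natDegree_tsub_one, coeff_divX,
        Nat.sub_add_cancel (Nat.one_le_iff_ne_zero.2 hpos)]
      exact hE
    refine ⟨(E.coeff 0, E.divX, v), ⟨trivial, ⟨hD, hv, hφv, ?_⟩, trivial⟩, ?_⟩
    · refine (hx.exists_mem_leadSet_iff hD (E.coeff 0) v l).1 ?_
      rw [hdecomp]
      exact hc
    · simp only [hdecomp]

end PolynomialColumns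

/-! ### Counting left invertible matrices with given leading columns -/

section PolynomialColumns

open Polynomial

variable {F : Type*} [Field F] {ι : Type*}

/-- The polynomial vector of degree at most `e` with leading coefficient `l` and lower
coefficients `g`. -/
noncomputable def leadPoly (e : ℕ) (l : ι → F) (g : Fin e → ι → F) : ι → F[X] :=
  fun k => monomial e (l k) + ∑ j : Fin e, monomial (j : ℕ) (g j k)

theorem coeff_leadPoly_lt {e : ℕ} (l : ι → F) (g : Fin e → ι → F) (k : ι) (i : Fin e) :
    (leadPoly e l g k).coeff i = g i k := by
  simp only [leadPoly, coeff_add, finsetSum_coeff, coeff_monomial, i.2.ne', if_false, zero_add,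
    Fin.val_inj]
  simp

theorem coeff_leadPoly_self {e : ℕ} (l : ι → F) (g : Fin e → ι → F) (k : ι) :
    (leadPoly e l g k).coeff e = l k := by
  simp only [leadPoly, coeff_add, finsetSum_coeff, coeff_monomial]
  simp [fun i : Fin e => i.2.ne]

theorem degree_leadPoly_le {e : ℕ} (l : ι → F) (g : Fin e → ι → F) (k : ι) :
    (leadPoly e l g k).degree ≤ (e : WithBot ℕ) := by
  refine (degree_add_le _ _).trans (max_le (degree_monomial_le _ _) ?_)
  refine (degree_sum_le _ _).trans (Finset.sup_le fun j _ => ?_)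
  exact (degree_monomial_le _ _).trans (by exact_mod_cast j.2.le)

theorem leadPoly_injective (e : ℕ) (l : ι → F) : Function.Injective (leadPoly e l) := by
  intro g g' h
  funext i k
  rw [← coeff_leadPoly_lt l g, h, coeff_leadPoly_lt]

theorem range_leadPoly (e : ℕ) (l : ι → F) : Set.range (leadPoly e l) = leadSet e l := by
  ext y
  constructor
  · rintro ⟨g, rfl⟩ k
    exact ⟨degree_leadPoly_le l g k, coeff_leadPoly_self l g k⟩
  · intro hy
    refine ⟨fun i k => (y k).coeff i, ?_⟩
    funext k
    ext j
    rcases lt_trichotomy j e with h | rfl | h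
    · exact coeff_leadPoly_lt l _ k ⟨j, h⟩
    · rw [coeff_leadPoly_self, (hy k).2]
    · rw [coeff_eq_zero_of_degree_lt ((degree_leadPoly_le l _ k).trans_lt (by exact_mod_cast h)),
        coeff_eq_zero_of_degree_lt ((hy k).1.trans_lt (by exact_mod_cast h))]

theorem ncard_leadSet [Finite F] [Fintype ι] (e : ℕ) (l : ι → F) :
    (leadSet e l).ncard = Nat.card F ^ (e * Fintype.card ι) := by
  rw [← range_leadPoly, Set.ncard_range_of_injective (leadPoly_injective e l)]
  simp [Nat.card_fun, ← pow_mul, mul_comm]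

theorem ncard_leadCosetSet [Finite F] [Fintype ι] {m : ℕ} (e : ℕ) (l : ι → F) {L : Fin m → ι → F}
    (hL : LinearIndependent F L) :
    (leadCosetSet e l L).ncard = Nat.card F ^ (e * Fintype.card ι + m) := by
  let f : (Fin m → F) × (Fin e → ι → F) → ι → F[X] := fun p =>
    leadPoly e (l + ∑ a, p.1 a • L a) p.2
  have hf : Function.Injective f := by
    rintro ⟨b, g⟩ ⟨b', g'⟩ h
    have h1 : b = b' := by
      have : ∑ a, (b - b') a • L a = 0 := by
        funext k
        have := congrArg (fun p => coeff p e) (congrFun h k)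
        simp only [f, coeff_leadPoly_self, Pi.add_apply, add_right_inj] at this
        simp only [Pi.sub_apply, sub_smul, Finset.sum_sub_distrib, Pi.zero_apply, this, sub_self]
      funext a
      exact sub_eq_zero.1 (Fintype.linearIndependent_iff.1 hL _ this a)
    subst h1
    exact Prod.ext rfl (leadPoly_injective e _ h)
  have hr : Set.range f = leadCosetSet e l L := by
    ext w
    constructor
    · rintro ⟨⟨b, g⟩, rfl⟩
      exact ⟨b, by rw [← range_leadPoly]; exact ⟨g, rfl⟩⟩
    · rintro ⟨b, hb⟩
      rw [← range_leadPoly] at hb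
      obtain ⟨g, rfl⟩ := hb
      exact ⟨(b, g), rfl⟩
  rw [← hr, Set.ncard_range_of_injective hf]
  simp [Nat.card_fun, ← pow_mul, pow_add, mul_comm]

theorem hasLeading_leadPoly {m e : ℕ} {L : Fin m → ι → F} (hL : LinearIndependent F L)
    (g : Fin m → Fin e → ι → F) : HasLeading e L fun a => leadPoly e (L a) (g a) where
  degree_lt _ k := natDegree_le_of_degree_le (degree_leadPoly_le _ _ k)
  coeff_eq _ k := coeff_leadPoly_self _ _ k
  indep := hL

theorem card_hasLeftInverse_cons [Finite F] [Fintype ι] {m s : ℕ} {L : Fin m → ι → F} {l : ι → F}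
    {x : Fin m → ι → F[X]} (hx : HasLeading (s + 1) L x) (hinv : HasLeftInverse x)
    (hl : l ∉ Submodule.span F (Set.range L)) :
    (Nat.card {g : Fin (s + 1) → ι → F //
        HasLeftInverse (Fin.cons (leadPoly (s + 1) l g) x : Fin (m + 1) → ι → F[X])} : ℝ) =
      (Nat.card F : ℝ) ^ ((s + 1) * Fintype.card ι) -
        (Nat.card F : ℝ) ^ (s * Fintype.card ι + m + 1) := by
  obtain ⟨φ, hφ⟩ := hinv
  have hfin : (leadSet (s + 1) l).Finite := by
    rw [← range_leadPoly]
    exact Set.finite_range _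
  have h1 := ncard_not_hasLeftInverse_cons hx hφ hl
  rw [ncard_leadCosetSet s l hx.indep, ← pow_succ'] at h1
  have h2 := Set.ncard_inter_add_ncard_sdiff_eq_ncard (leadSet (s + 1) l)
    {y | HasLeftInverse (Fin.cons y x : Fin (m + 1) → ι → F[X])} hfin
  have h3 : leadSet (s + 1) l \ {y | HasLeftInverse (Fin.cons y x : Fin (m + 1) → ι → F[X])} =
      {y ∈ leadSet (s + 1) l |
        ¬ HasLeftInverse (Fin.cons y x : Fin (m + 1) → ι → F[X])} := rfl
  rw [h3, h1, ncard_leadSet] at h2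
  have h4 : Nat.card {g : Fin (s + 1) → ι → F //
      HasLeftInverse (Fin.cons (leadPoly (s + 1) l g) x : Fin (m + 1) → ι → F[X])} =
      (leadSet (s + 1) l ∩
        {y | HasLeftInverse (Fin.cons y x : Fin (m + 1) → ι → F[X])}).ncard := by
    rw [← range_leadPoly, Set.inter_comm, ← Set.image_preimage_eq_inter_range,
      Set.ncard_image_of_injective _ (leadPoly_injective _ _)]
    rfl
  rw [h4, eq_sub_iff_add_eq]
  exact_mod_cast h2

/-- The number of left invertible polynomial matrices with prescribed independent leading
coefficients. -/
theorem card_hasLeftInverse_leadPoly [Finite F] [Fintype ι] {m s : ℕ} {L : Fin m → ι → F}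
    (hL : LinearIndependent F L) :
    (Nat.card {g : Fin m → Fin (s + 1) → ι → F //
        HasLeftInverse fun a => leadPoly (s + 1) (L a) (g a)} : ℝ) =
      ∏ i ∈ Finset.range m, ((Nat.card F : ℝ) ^ ((s + 1) * Fintype.card ι) -
        (Nat.card F : ℝ) ^ (s * Fintype.card ι + i + 1)) := by
  classical
  cases nonempty_fintype F
  induction m with
  | zero =>
    have : Nat.card {g : Fin 0 → Fin (s + 1) → ι → F //
        HasLeftInverse fun a => leadPoly (s + 1) (L a) (g a)} = 1 := by
      rw [Nat.card_eq_one_iff_unique]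
      exact ⟨inferInstance, ⟨⟨Fin.elim0, Fin.elim0, fun a => a.elim0⟩⟩⟩
    rw [this]
    simp
  | succ m ih =>
    obtain ⟨hL', hl⟩ := linearIndependent_finSucc.1 hL
    have key : ∀ (y : Fin (s + 1) → ι → F) (t : Fin m → Fin (s + 1) → ι → F),
        (fun a => leadPoly (s + 1) (L a) ((Fin.cons y t : Fin (m + 1) → _) a)) =
          (Fin.cons (leadPoly (s + 1) (L 0) y)
            (fun a => leadPoly (s + 1) (Fin.tail L a) (t a)) : Fin (m + 1) → ι → F[X]) := by
      intro y t
      funext a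
      refine Fin.cases ?_ (fun a => ?_) a <;> simp [Fin.tail]
    -- Peel off the first column: the others stay left invertible, and each choice of them has the
    -- same number of completions.
    let e : {g : Fin (m + 1) → Fin (s + 1) → ι → F //
        HasLeftInverse fun a => leadPoly (s + 1) (L a) (g a)} ≃
        Σ t : {t : Fin m → Fin (s + 1) → ι → F //
          HasLeftInverse fun a => leadPoly (s + 1) (Fin.tail L a) (t a)},
          {y : Fin (s + 1) → ι → F // HasLeftInverse
            (Fin.cons (leadPoly (s + 1) (L 0) y)
              (fun a => leadPoly (s + 1) (Fin.tail L a) (t.1 a)) : Fin (m + 1) → ι → F[X])} :=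
      { toFun := fun g =>
          have h : HasLeftInverse (Fin.cons (leadPoly (s + 1) (L 0) (g.1 0))
              (fun a => leadPoly (s + 1) (Fin.tail L a) (Fin.tail g.1 a)) :
                Fin (m + 1) → ι → F[X]) := by
            rw [← key, Fin.cons_self_tail]
            exact g.2
          ⟨⟨Fin.tail g.1, h.of_cons⟩, ⟨g.1 0, h⟩⟩
        invFun := fun p => ⟨Fin.cons p.2.1 p.1.1, by rw [key]; exact p.2.2⟩
        left_inv := fun g => Subtype.ext (Fin.cons_self_tail g.1)
        right_inv := fun p => rfl }
    rw [Nat.card_congr e, Nat.card_sigma, Nat.cast_sum,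
      Finset.sum_congr rfl fun t _ => card_hasLeftInverse_cons
        (hasLeading_leadPoly hL' t.1) t.2 hl,
      Finset.sum_const, nsmul_eq_mul, Finset.card_univ, ← Nat.card_eq_fintype_card, ih hL',
      Finset.prod_range_succ]

end PolynomialColumns

/-! ### Left invertibility and linear recurrences -/

section Sequences

open Polynomial

variable {F : Type*} [Field F] {ι : Type*}

/-- The shift operator on sequences. -/
def seqShift (F : Type*) [Field F] : Module.End F (ℕ → F) := LinearMap.funLeft F F Nat.succ

theorem seqShift_pow_apply (n : ℕ) (b : ℕ → F) (i : ℕ) : (seqShift F ^ n) b i = b (i + n) := by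
  induction n generalizing i with
  | zero => simp
  | succ n ih =>
    rw [pow_succ', Module.End.mul_apply]
    exact (ih (i + 1)).trans (congrArg b (by omega))

theorem aeval_seqShift_monomial (n : ℕ) (c : F) (b : ℕ → F) (i : ℕ) :
    aeval (seqShift F) (monomial n c) b i = c * b (i + n) := by
  rw [aeval_monomial, Module.End.mul_apply, Module.algebraMap_end_apply, Pi.smul_apply,
    seqShift_pow_apply, smul_eq_mul]

/-- A polynomial matrix has a left inverse if and only if its columns, as recurrences, have no
common nonzero solution. -/
theorem hasLeftInverse_iff_sequences [Fintype ι] {m : ℕ} (x : Fin m → ι → F[X]) :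
    HasLeftInverse x ↔
      ∀ b : Fin m → ℕ → F, (∀ k, ∑ a, aeval (seqShift F) (x a k) (b a) = 0) → b = 0 := by
  classical
  constructor
  · rintro ⟨φ, hφ⟩ b hb
    funext a'
    have h1 : ∑ k, aeval (seqShift F) (φ a' k) (∑ a, aeval (seqShift F) (x a k) (b a)) = 0 := by
      simp [hb]
    have h2 : ∑ k, aeval (seqShift F) (φ a' k) (∑ a, aeval (seqShift F) (x a k) (b a)) =
        ∑ a, aeval (seqShift F) (φ a' ⬝ᵥ x a) (b a) := by
      simp only [map_sum, dotProduct, LinearMap.sum_apply, map_mul, Module.End.mul_apply]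
      exact Finset.sum_comm
    rw [h2] at h1
    simpa [hφ, apply_ite (aeval (seqShift F)), ite_apply, DFunLike.ite_apply] using h1
  · intro h
    let R : Submodule F[X] (Fin m → F[X]) := Submodule.span F[X] (Set.range fun k a => x a k)
    by_cases hR : R = ⊤
    · have : ∀ a, ∃ ψ : ι → F[X], ∑ k, ψ k • (fun a => x a k) = Pi.single a 1 := fun a =>
        (Submodule.mem_span_range_iff_exists_fun F[X]).1
          (hR ▸ Submodule.mem_top : Pi.single a 1 ∈ R)
      choose φ hφ using this
      refine ⟨φ, fun a b => ?_⟩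
      have := congrFun (hφ a) b
      simpa [dotProduct, Pi.single_apply, eq_comm] using this
    · exfalso
      have hlt : R.restrictScalars F < ⊤ := by
        rw [lt_top_iff_ne_top]
        intro h'
        apply hR
        rwa [Submodule.restrictScalars_eq_top_iff] at h'
      obtain ⟨f, hf0, hf⟩ := Submodule.exists_le_ker_of_lt_top _ hlt
      let b : Fin m → ℕ → F := fun a i => f (Pi.single a (X ^ i))
      have key : ∀ (p : F[X]) a i,
          aeval (seqShift F) p (b a) i = f (Pi.single a (p * X ^ i)) := by
        intro p a i
        induction p using Polynomial.induction_on' with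
        | add p q hp hq =>
          rw [map_add, LinearMap.add_apply, Pi.add_apply, hp, hq, add_mul, Pi.single_add, map_add]
        | monomial n c =>
          rw [aeval_seqShift_monomial, ← smul_eq_mul, ← map_smul, ← Pi.single_smul,
            ← C_mul_X_pow_eq_monomial, mul_assoc, ← pow_add, smul_eq_C_mul, add_comm]
      have hb := h b fun k => by
        funext i
        rw [Finset.sum_apply]
        simp only [key]
        rw [← map_sum]
        have : (X ^ i : F[X]) • (fun a => x a k) ∈ R :=
          R.smul_mem _ (Submodule.subset_span ⟨k, rfl⟩)
        have h3 := hf this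
        rw [LinearMap.mem_ker] at h3
        rw [Pi.zero_apply, ← h3]
        congr 1
        funext a
        simp [Finset.sum_apply, Pi.single_apply, mul_comm]
      apply hf0
      refine LinearMap.ext fun v => ?_
      rw [← Finset.univ_sum_single v, map_sum]
      refine Finset.sum_eq_zero fun a _ => ?_
      have h4 := key (v a) a 0
      rw [hb] at h4
      simpa using h4.symm

theorem aeval_seqShift_leadPoly {e : ℕ} (l : ι → F) (g : Fin e → ι → F) (k : ι) (b : ℕ → F)
    (i : ℕ) :
    aeval (seqShift F) (leadPoly e l g k) b i =
      l k * b (i + e) + ∑ j : Fin e, g j k * b (i + j) := by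
  rw [leadPoly, map_add, map_sum, LinearMap.add_apply, LinearMap.sum_apply, Pi.add_apply,
    Finset.sum_apply, aeval_seqShift_monomial]
  simp only [aeval_seqShift_monomial]

end Sequences

/-! ### Block companion matrices and observability -/

section Companion

variable {F : Type*} [Field F] {ι : Type*} {s r : ℕ}

theorem blockCompanion_mulVec_zero (A : Fin (s + 1) → Matrix (Fin r) (Fin r) F)
    (w : Fin (s + 1) × Fin r → F) (c : Fin r) :
    (blockCompanion A).mulVec w (0, c) = ∑ p : Fin (s + 1) × Fin r, A p.1 c p.2 * w p := by
  simp [Matrix.mulVec, dotProduct, blockCompanion]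

theorem blockCompanion_mulVec_succ (A : Fin (s + 1) → Matrix (Fin r) (Fin r) F)
    (w : Fin (s + 1) × Fin r → F) (j : Fin s) (c : Fin r) :
    (blockCompanion A).mulVec w (j.succ, c) = w (j.castSucc, c) := by
  rw [Matrix.mulVec, dotProduct, Finset.sum_eq_single (j.castSucc, c)]
  · simp [blockCompanion]
  · rintro ⟨j', c'⟩ - h
    simp only [blockCompanion, Matrix.of_apply, Fin.val_succ, Nat.succ_ne_zero, if_false,
      Matrix.one_apply]
    by_cases h1 : (j : ℕ) + 1 = j' + 1
    · have h2 : j' = j.castSucc := Fin.ext (by simp; omega)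
      subst h2
      have h3 : c ≠ c' := fun h3 => h (by rw [h3])
      simp [h3]
    · rw [if_neg h1, zero_mul]
  · simp

/-- The states of a recurrence are the iterates of its block companion matrix. -/
theorem blockCompanion_pow_mulVec_of_recurrence {A : Fin (s + 1) → Matrix (Fin r) (Fin r) F}
    {b : Fin r → ℕ → F}
    (hb : ∀ i c, b c (i + (s + 1)) =
      ∑ p : Fin (s + 1) × Fin r, A p.1 c p.2 * b p.2 (i + p.1.rev)) (i : ℕ) :
    (blockCompanion A ^ i).mulVec (fun p => b p.2 p.1.rev) =
      fun p : Fin (s + 1) × Fin r => b p.2 (i + p.1.rev) := by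
  induction i with
  | zero => simp
  | succ i ih =>
    rw [pow_succ', ← Matrix.mulVec_mulVec, ih]
    funext ⟨j, c⟩
    refine Fin.cases ?_ (fun j => ?_) j
    · rw [blockCompanion_mulVec_zero, ← hb]
      congr 1
      simp
      omega
    · rw [blockCompanion_mulVec_succ]
      have : (j.castSucc.rev : ℕ) = j.succ.rev + 1 := by
        simp only [Fin.val_rev, Fin.val_succ, Fin.val_castSucc]
        omega
      simp only [this]
      congr 1
      omega

theorem exists_recurrence_of_blockCompanion (A : Fin (s + 1) → Matrix (Fin r) (Fin r) F)
    (w : Fin (s + 1) × Fin r → F) :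
    ∃ b : Fin r → ℕ → F, (∀ i c, b c (i + (s + 1)) =
        ∑ p : Fin (s + 1) × Fin r, A p.1 c p.2 * b p.2 (i + p.1.rev)) ∧
      w = fun p => b p.2 p.1.rev := by
  -- The last block holds the oldest term of the window, so reading it along the orbit yields the
  -- sequence without shift.
  let b : Fin r → ℕ → F := fun c i => (blockCompanion A ^ i).mulVec w (Fin.last s, c)
  have hshift : ∀ (n : ℕ) (j : Fin (s + 1)), (j : ℕ) + n = s → ∀ i c,
      (blockCompanion A ^ i).mulVec w (j, c) = b c (i + n) := by
    intro n
    induction n with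
    | zero =>
      intro j hj i c
      rw [show j = Fin.last s from Fin.ext (by simpa using hj)]
      rfl
    | succ n ih =>
      intro j hj i c
      have hj' : (j : ℕ) < s := by omega
      have := ih (Fin.succ ⟨j, hj'⟩) (by simp; omega) (i + 1) c
      rw [pow_succ', ← Matrix.mulVec_mulVec, blockCompanion_mulVec_succ] at this
      rw [show i + (n + 1) = i + 1 + n by omega, ← this]
      rfl
  have hrev : ∀ i (p : Fin (s + 1) × Fin r),
      (blockCompanion A ^ i).mulVec w p = b p.2 (i + p.1.rev) := fun i p =>
    hshift _ p.1 (by simp only [Fin.val_rev]; omega) i p.2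
  refine ⟨b, fun i c => ?_, ?_⟩
  · have h0 := hrev (i + 1) (0, c)
    rw [pow_succ', ← Matrix.mulVec_mulVec, blockCompanion_mulVec_zero] at h0
    simp only [hrev] at h0
    rw [h0]
    congr 1
    simp
    omega
  · funext p
    simpa using hrev 0 p

/-- Observability of a block companion matrix in terms of the sequences that satisfy its
recurrence. -/
theorem blockCompanion_observable_iff [Fintype ι] (A : Fin (s + 1) → Matrix (Fin r) (Fin r) F)
    (C : Matrix ι (Fin (s + 1) × Fin r) F) :
    (∀ w, (∀ i : ℕ, C.mulVec ((blockCompanion A ^ i).mulVec w) = 0) → w = 0) ↔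
      ∀ b : Fin r → ℕ → F,
        (∀ i c, b c (i + (s + 1)) =
          ∑ p : Fin (s + 1) × Fin r, A p.1 c p.2 * b p.2 (i + p.1.rev)) →
        (∀ i k, ∑ p, C k p * b p.2 (i + p.1.rev) = 0) → b = 0 := by
  constructor
  · intro h b hb hC
    have hw : (fun p : Fin (s + 1) × Fin r => b p.2 p.1.rev) = 0 := h _ fun i => by
      rw [blockCompanion_pow_mulVec_of_recurrence hb]
      funext k
      exact hC i k
    funext c i
    have := congrFun (blockCompanion_pow_mulVec_of_recurrence hb i) (Fin.last s, c)
    rw [hw, Matrix.mulVec_zero] at this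
    simpa using this.symm
  · intro h w hw
    obtain ⟨b, hb, rfl⟩ := exists_recurrence_of_blockCompanion A w
    rw [h b hb fun i k => by
      have := congrFun (hw i) k
      rwa [blockCompanion_pow_mulVec_of_recurrence hb] at this]
    rfl

/-- By the Cayley–Hamilton theorem, finitely many powers suffice for observability. -/
theorem mulVec_pow_eq_zero_of_lt {κ : Type*} [Fintype κ] [DecidableEq κ] {A : Matrix κ κ F}
    {C : Matrix ι κ F} {w : κ → F} {t : ℕ} (ht : Fintype.card κ ≤ t)
    (h : ∀ i < t, C.mulVec ((A ^ i).mulVec w) = 0) (i : ℕ) :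
    C.mulVec ((A ^ i).mulVec w) = 0 := by
  rcases isEmpty_or_nonempty κ with hκ | hκ
  · funext k
    simp [Matrix.mulVec, dotProduct]
  have hmonic := A.charpoly_monic
  have hdeg : ((Polynomial.X ^ i : Polynomial F) %ₘ A.charpoly).natDegree < t := by
    refine lt_of_lt_of_le ?_ ht
    rw [← A.charpoly_natDegree_eq_dim]
    refine Polynomial.natDegree_modByMonic_lt _ hmonic fun h1 => ?_
    have := A.charpoly_natDegree_eq_dim
    rw [h1, Polynomial.natDegree_one] at this
    exact Fintype.card_ne_zero this.symm
  rw [Matrix.pow_eq_aeval_mod_charpoly, Polynomial.aeval_eq_sum_range' hdeg]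
  rw [Matrix.sum_mulVec, Matrix.mulVec_sum]
  refine Finset.sum_eq_zero fun j hj => ?_
  rw [Matrix.smul_mulVec, Matrix.mulVec_smul, h j (Finset.mem_range.1 hj), smul_zero]

theorem rank_eq_card_iff {μ κ : Type*} [Fintype μ] [Fintype κ] (M : Matrix μ κ F) :
    M.rank = Fintype.card κ ↔ ∀ v, M.mulVec v = 0 → v = 0 := by
  classical
  have h := M.mulVecLin.finrank_range_add_finrank_ker
  rw [Module.finrank_fintype_fun_eq_card] at h
  rw [Matrix.rank, ← Matrix.ker_mulVecLin_eq_bot_iff, ← Submodule.finrank_eq_zero (R := F)]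
  omega

theorem rank_stackedPowers_eq_iff [Fintype ι] {κ : Type*} [Fintype κ] [DecidableEq κ] {t : ℕ}
    (ht : Fintype.card κ ≤ t) (Z : Matrix ι κ F) (A : Matrix κ κ F) :
    (stackedPowers t Z A).rank = Fintype.card κ ↔
      ∀ w, (∀ i : ℕ, Z.mulVec ((A ^ i).mulVec w) = 0) → w = 0 := by
  rw [rank_eq_card_iff]
  have key : ∀ w, (stackedPowers t Z A).mulVec w = 0 ↔
      ∀ i < t, Z.mulVec ((A ^ i).mulVec w) = 0 := by
    intro w
    constructor
    · intro h i hi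
      funext k
      rw [Matrix.mulVec_mulVec]
      exact congrFun h (⟨i, hi⟩, k)
    · intro h
      funext ⟨i, k⟩
      have := congrFun (h i i.2) k
      rw [Matrix.mulVec_mulVec] at this
      exact this
  refine forall_congr' fun w => ?_
  rw [key]
  exact ⟨fun h h' => h fun i _ => h' i, fun h h' => h (mulVec_pow_eq_zero_of_lt ht h')⟩

end Companion

/-! ### Rank conditions as left invertibility -/

section Rank

variable {F : Type*} [Field F] {ι : Type*} {s r : ℕ}

/-- The lower terms are summed through `rev` to match companion states, which list the newest term
first. -/
theorem hasLeftInverse_leadPoly_iff [Fintype ι] {e : ℕ} (L : Fin r → ι → F)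
    (g : Fin r → Fin e → ι → F) :
    HasLeftInverse (fun a => leadPoly e (L a) (g a)) ↔
      ∀ b : Fin r → ℕ → F, (∀ i k, ∑ a, L a k * b a (i + e) +
        ∑ p : Fin e × Fin r, g p.2 p.1.rev k * b p.2 (i + p.1.rev) = 0) → b = 0 := by
  rw [hasLeftInverse_iff_sequences]
  refine forall_congr' fun b => imp_congr_left ?_
  rw [forall_comm]
  refine forall_congr' fun k => ?_
  rw [funext_iff]
  refine forall_congr' fun i => ?_
  have hrev : ∀ a, ∑ j : Fin e, g a j.rev k * b a (i + j.rev) =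
      ∑ j : Fin e, g a j k * b a (i + j) :=
    fun a => Equiv.sum_comp Fin.revPerm fun j : Fin e => g a j k * b a (i + j)
  rw [Finset.sum_apply, Fintype.sum_prod_type_right]
  simp only [aeval_seqShift_leadPoly, Finset.sum_add_distrib, hrev, Pi.zero_apply]

/-- The lower coefficients of the polynomial matrix that belongs to `Z` and a block companion
matrix. -/
def companionCoeffs {u : ℕ} (Z : Matrix (Fin u) (Fin (s + 1) × Fin r) F)
    (A : Fin (s + 1) → Matrix (Fin r) (Fin r) F) :
    Fin r → Fin (s + 1) → Fin r ⊕ Fin u → F :=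
  fun a j => Sum.elim (fun c => -A j.rev c a) (fun k => Z k (j.rev, a))

/-- The upper `r` rows of the polynomial matrix encode the recurrence of `A`, whence the identity as
leading coefficient and the sign of `A`; the lower `u` rows encode the output `Z`. -/
theorem rank_stackedPowers_blockCompanion_eq_iff {u t : ℕ} (ht : r * (s + 1) ≤ t)
    (Z : Matrix (Fin u) (Fin (s + 1) × Fin r) F) (A : Fin (s + 1) → Matrix (Fin r) (Fin r) F) :
    (stackedPowers t Z (blockCompanion A)).rank = r * (s + 1) ↔
      HasLeftInverse fun a => leadPoly (s + 1)
        (Sum.elim (Pi.single a 1) 0 : Fin r ⊕ Fin u → F) (companionCoeffs Z A a) := by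
  have hcard : Fintype.card (Fin (s + 1) × Fin r) = r * (s + 1) := by simp [mul_comm]
  rw [← hcard, rank_stackedPowers_eq_iff (hcard.trans_le ht), blockCompanion_observable_iff,
    hasLeftInverse_leadPoly_iff]
  refine forall_congr' fun b => ?_
  rw [← and_imp]
  refine imp_congr_left ?_
  rw [← forall_and]
  refine forall_congr' fun i => ?_
  rw [Sum.forall]
  refine and_congr (forall_congr' fun c => ?_) (forall_congr' fun k => ?_)
  · simp [companionCoeffs, Pi.single_apply, ← sub_eq_add_neg, sub_eq_zero]
  · simp [companionCoeffs]

theorem expandedSyndromeMatrix_mulVec {N d t : ℕ} (X : Fin d → Matrix (Fin N) (Fin r) F)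
    (v : ℕ → Fin r → F) (i : Fin t) (k : Fin N) :
    (expandedSyndromeMatrix t X).mulVec (fun p => v p.1 p.2) (i, k) =
      ∑ m : Fin d, ∑ c, X m k c * v (i + m) c := by
  rw [Matrix.mulVec, dotProduct, Fintype.sum_prod_type]
  symm
  refine Finset.sum_of_injOn (fun m : Fin d => (⟨i + m, by omega⟩ : Fin (d + t - 1))) ?_ ?_ ?_ ?_
  · intro m _ m' _ h
    simpa [Fin.ext_iff] using h
  · intro m _
    simp
  · intro j _ hj
    refine Finset.sum_eq_zero fun c _ => ?_
    rw [expandedSyndromeMatrix, Matrix.of_apply, dif_neg, zero_mul]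
    rintro ⟨h1, h2⟩
    refine hj ⟨⟨j.val - i.val, h2⟩, by simp, ?_⟩
    exact Fin.ext (Nat.add_sub_cancel' h1)
  · intro m _
    refine Finset.sum_congr rfl fun c _ => ?_
    simp [expandedSyndromeMatrix]

/-- A kernel vector is a finite window of a recurrence read backwards. A left inverse of `X 0`
expresses each block through the next `s + 1`, so the window is a companion orbit starting from its
last `s + 1` blocks; its `t` output conditions suffice by Cayley–Hamilton. -/
theorem eq_zero_of_expandedSyndromeMatrix_recurrence {N t : ℕ} (ht : r * (s + 1) ≤ t)
    {X : Fin (s + 2) → Matrix (Fin N) (Fin r) F} (hX : LinearIndependent F fun a k => X 0 k a)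
    (hinv : HasLeftInverse fun a => leadPoly (s + 1) (fun k => X 0 k a)
      fun j k => X j.rev.succ k a)
    {v : ℕ → Fin r → F} (hv : ∀ i < t, ∀ k, ∑ m : Fin (s + 2), ∑ c, X m k c * v (i + m) c = 0)
    {n : ℕ} (hn : n < t + (s + 1)) : v n = 0 := by
  rw [hasLeftInverse_leadPoly_iff] at hinv
  obtain ⟨G, hG⟩ : ∃ G : Matrix (Fin r) (Fin N) F, G * X 0 = 1 := by
    have hker : LinearMap.ker (X 0).mulVecLin = ⊥ := by
      rw [LinearMap.ker_eq_bot]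
      exact Matrix.mulVec_injective_iff.2 hX
    obtain ⟨G, hG⟩ := LinearMap.exists_leftInverse_of_injective _ hker
    refine ⟨LinearMap.toMatrix' G, ?_⟩
    have := congrArg LinearMap.toMatrix' hG
    rwa [LinearMap.toMatrix'_comp, LinearMap.toMatrix'_id, ← Matrix.toLin'_apply',
      LinearMap.toMatrix'_toLin'] at this
  -- Multiplying a block row by `G` gives `v i` as the `A`-combination of the later blocks; `C` is
  -- what remains of the block row after this substitution.
  let A : Fin (s + 1) → Matrix (Fin r) (Fin r) F := fun j => -(G * X j.succ)
  let C : Matrix (Fin N) (Fin (s + 1) × Fin r) F :=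
    Matrix.of fun k p => (X 0 * A p.1) k p.2 + X p.1.succ k p.2
  have hA : ∀ (w : Fin (s + 1) × Fin r → F) c, ∑ p, A p.1 c p.2 * w p =
      -∑ k, G c k * ∑ p : Fin (s + 1) × Fin r, X p.1.succ k p.2 * w p := by
    intro w c
    simp only [A, Matrix.neg_apply, Matrix.mul_apply, neg_mul, Finset.sum_neg_distrib,
      Finset.sum_mul, Finset.mul_sum]
    rw [Finset.sum_comm]
    simp only [mul_assoc]
  have hC : ∀ (w : Fin (s + 1) × Fin r → F) k, ∑ p, C k p * w p =
      ∑ c, X 0 k c * (∑ p, A p.1 c p.2 * w p) +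
        ∑ p : Fin (s + 1) × Fin r, X p.1.succ k p.2 * w p := by
    intro w k
    simp only [C, Matrix.of_apply, Matrix.mul_apply, add_mul, Finset.sum_add_distrib,
      Finset.sum_mul, Finset.mul_sum]
    rw [Finset.sum_comm]
    simp only [mul_assoc]
  have hv' : ∀ i < t, ∀ k, ∑ c, X 0 k c * v i c +
      ∑ p : Fin (s + 1) × Fin r, X p.1.succ k p.2 * v (i + 1 + p.1) p.2 = 0 := by
    intro i hi k
    rw [← hv i hi k, Fin.sum_univ_succ, Fintype.sum_prod_type]
    simp only [Fin.val_zero, add_zero, Fin.val_succ, add_assoc, add_comm 1]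
  have hstep : ∀ i < t, ∀ c, ∑ p : Fin (s + 1) × Fin r, A p.1 c p.2 * v (i + 1 + p.1) p.2 =
      v i c := by
    intro i hi c
    rw [hA, ← Finset.sum_neg_distrib]
    simp only [fun k => eq_neg_of_add_eq_zero_right (hv' i hi k), mul_neg, neg_neg,
      Finset.mul_sum]
    rw [Finset.sum_comm]
    have : ∀ a, ∑ k, G c k * (X 0 k a * v i a) = (1 : Matrix (Fin r) (Fin r) F) c a * v i a := by
      intro a
      rw [← hG, Matrix.mul_apply, Finset.sum_mul]
      simp only [mul_assoc]
    simp [this, Matrix.one_apply]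
  let w : Fin (s + 1) × Fin r → F := fun p => v (t + p.1) p.2
  have hpow : ∀ i ≤ t, (blockCompanion A ^ i).mulVec w = fun p => v (t - i + p.1) p.2 := by
    intro i
    induction i with
    | zero => simp [w]
    | succ i ih =>
      intro hi
      rw [pow_succ', ← Matrix.mulVec_mulVec, ih (by omega)]
      funext ⟨j, c⟩
      have e : t - i = t - (i + 1) + 1 := by omega
      refine Fin.cases ?_ (fun j => ?_) j
      · rw [blockCompanion_mulVec_zero, e, hstep _ (by omega)]
        simp
      · rw [blockCompanion_mulVec_succ]
        simp only [Fin.val_castSucc, Fin.val_succ, e]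
        congr 1
        omega
  have hCw : ∀ i < t, C.mulVec ((blockCompanion A ^ i).mulVec w) = 0 := by
    intro i hi
    rw [hpow i hi.le]
    funext k
    have e : t - i = t - (i + 1) + 1 := by omega
    simp only [Matrix.mulVec, dotProduct]
    rw [hC, e]
    simp only [hstep _ (show t - (i + 1) < t by omega)]
    exact hv' _ (by omega) k
  have hobs := (blockCompanion_observable_iff A C).2 fun b hb hCb => hinv b fun i k => by
    rw [← hCb i k, hC]
    simp only [← hb, Fin.rev_rev]
  have hw : w = 0 := hobs w
    (mulVec_pow_eq_zero_of_lt (by simpa [mul_comm] using ht) hCw)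
  rcases le_total n t with h | h
  · funext c
    have := congrFun (hpow (t - n) (Nat.sub_le _ _)) (0, c)
    rw [hw, Matrix.mulVec_zero] at this
    simpa [Nat.sub_sub_self h] using this.symm
  · funext c
    have := congrFun hw (⟨n - t, by omega⟩, c)
    simpa [w, Nat.add_sub_cancel' h] using this

theorem rank_expandedSyndromeMatrix_eq_iff {N t : ℕ} (ht : r * (s + 1) ≤ t)
    (X : Fin (s + 2) → Matrix (Fin N) (Fin r) F) :
    (expandedSyndromeMatrix t X).rank = r * (s + 2 + t - 1) ↔
      LinearIndependent F (fun a k => X 0 k a) ∧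
        HasLeftInverse fun a => leadPoly (s + 1) (fun k => X 0 k a)
          fun j k => X j.rev.succ k a := by
  have hcard : Fintype.card (Fin (s + 2 + t - 1) × Fin r) = r * (s + 2 + t - 1) := by
    simp [mul_comm]
  rw [← hcard, rank_eq_card_iff]
  constructor
  · intro h
    constructor
    · rw [Fintype.linearIndependent_iff]
      intro g hg a
      -- The first block column contains only `X 0`, in the first block row, so a relation among its
      -- columns is a kernel vector.
      have h0 := h (fun p => (fun n c => if n = 0 then g c else 0 : ℕ → Fin r → F) p.1 p.2) (by
        funext ⟨i, k⟩
        refine (expandedSyndromeMatrix_mulVec X (fun n c => if n = 0 then g c else 0) i k).trans ?_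
        rw [Fin.sum_univ_succ]
        by_cases hi : (i : ℕ) = 0
        · simpa [hi, mul_comm] using congrFun hg k
        · simp [hi])
      simpa using congrFun h0 (⟨0, by omega⟩, a)
    · rw [hasLeftInverse_leadPoly_iff]
      intro b hb
      funext c n
      -- The reversed window of `b` ending at time `n`: block row `i` becomes the recurrence at time
      -- `n + (t - 1 - i)`, and the last block is `b` at `n`.
      have h0 := h (fun p => (fun m c => b c (n + (s + t - m)) : ℕ → Fin r → F) p.1 p.2) (by
        funext ⟨i, k⟩
        refine (expandedSyndromeMatrix_mulVec X (fun m c => b c (n + (s + t - m))) i k).trans ?_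
        rw [Fin.sum_univ_succ, Pi.zero_apply,
          ← hb (n + (t - 1 - i)) k, Fintype.sum_prod_type]
        have hi := i.2
        congr 1
        · refine Finset.sum_congr rfl fun c _ => ?_
          congr 2
          simp
          omega
        · refine Finset.sum_congr rfl fun m _ => Finset.sum_congr rfl fun c _ => ?_
          rw [Fin.rev_rev]
          congr 2
          simp only [Fin.val_succ, Fin.val_rev]
          omega)
      have := congrFun h0 (⟨s + t, by omega⟩, c)
      simpa using this
  · rintro ⟨hX, hinv⟩ v hv
    let V : ℕ → Fin r → F := fun n c => if h : n < s + 2 + t - 1 then v (⟨n, h⟩, c) else 0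
    have hV : v = fun p => V p.1 p.2 := by
      funext p
      simp only [V]
      rw [dif_pos p.1.2]
    have key : ∀ i < t, ∀ k, ∑ m : Fin (s + 2), ∑ c, X m k c * V (i + m) c = 0 := by
      intro i hi k
      rw [← expandedSyndromeMatrix_mulVec X V ⟨i, hi⟩ k, ← hV, hv]
      rfl
    rw [hV]
    funext p
    exact congrFun (eq_zero_of_expandedSyndromeMatrix_recurrence ht hX hinv key
      (by have := p.1.2; omega)) p.2

end Rank

/-! ### Exact probabilities -/

section Probability

theorem uniformProb_eq_card_div (Ω : Type*) [Fintype Ω] [Nonempty Ω] (p : Ω → Prop) :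
    uniformProb Ω {ω | p ω} = (Nat.card {ω // p ω} : ℝ) / Nat.card Ω := by
  classical
  rw [uniformProb, PMF.toOuterMeasure_uniformOfFintype_apply, ENNReal.toReal_div,
    ENNReal.toReal_natCast, ENNReal.toReal_natCast, ← Nat.card_eq_fintype_card,
    ← Nat.card_eq_fintype_card]
  rfl

theorem prod_sub_pow_eq {q : ℝ} (hq : q ≠ 0) (N e r : ℕ) (f : ℕ → ℕ) :
    ∏ i ∈ Finset.range r, (q ^ (e + N) - q ^ (e + f i)) =
      q ^ ((e + N) * r) * ∏ i ∈ Finset.range r, (1 - q ^ ((f i : ℤ) - N)) := by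
  have : q ^ ((e + N) * r) = ∏ _i ∈ Finset.range r, q ^ (e + N) := by
    rw [Finset.prod_const, Finset.card_range, ← pow_mul]
  rw [this, ← Finset.prod_mul_distrib]
  refine Finset.prod_congr rfl fun i _ => ?_
  rw [mul_sub, mul_one, ← zpow_natCast, ← zpow_natCast, ← zpow_add₀ hq]
  congr 2
  push_cast
  ring

theorem linearIndependent_sumElim_single (F : Type*) [Field F] (u r : ℕ) :
    LinearIndependent F fun a : Fin r => (Sum.elim (Pi.single a 1) 0 : Fin r ⊕ Fin u → F) := by
  rw [Fintype.linearIndependent_iff]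
  intro g hg a
  simpa [Pi.single_apply] using congrFun hg (Sum.inl a)

variable {F : Type*} [Field F] [Fintype F] {s r : ℕ}

theorem card_linearIndependent_columns (N r : ℕ) :
    (Nat.card {L : Fin r → Fin N → F // LinearIndependent F L} : ℝ) =
      ∏ i ∈ Finset.range r, ((Fintype.card F : ℝ) ^ N - (Fintype.card F : ℝ) ^ i) := by
  rcases le_or_gt r N with h | h
  · have h1 : r ≤ Module.finrank F (Fin N → F) := by simpa using h
    rw [card_linearIndependent h1, Nat.cast_prod, ← Fin.prod_univ_eq_prod_range
      (fun i => (Fintype.card F : ℝ) ^ N - (Fintype.card F : ℝ) ^ i)]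
    refine Finset.prod_congr rfl fun i _ => ?_
    rw [Module.finrank_fin_fun, Nat.cast_sub (Nat.pow_le_pow_right Fintype.card_pos
      (i.2.le.trans h))]
    simp
  · rw [Finset.prod_eq_zero (Finset.mem_range.2 h) (sub_self _)]
    have : IsEmpty {L : Fin r → Fin N → F // LinearIndependent F L} := by
      refine ⟨fun L => ?_⟩
      have := L.2.fintype_card_le_finrank
      simp at this
      omega
    simp

/-- The blocks of the expanded-syndrome matrix as leading and lower coefficients of polynomial
columns. -/
def blocksEquiv (F : Type*) (N r s : ℕ) : (Fin (s + 2) → Matrix (Fin N) (Fin r) F) ≃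
    (Fin r → Fin N → F) × (Fin r → Fin (s + 1) → Fin N → F) where
  toFun X := (fun a k => X 0 k a, fun a j k => X j.rev.succ k a)
  invFun p := Fin.cons (Matrix.of fun k a => p.1 a k) fun j => Matrix.of fun k a => p.2 a j.rev k
  left_inv X := by
    funext m
    refine Fin.cases ?_ (fun m => ?_) m
    · rfl
    · ext k a
      simp
  right_inv p := by
    refine Prod.ext rfl ?_
    funext a j k
    simp

/-- The pairs `(Z, A)` as lower coefficients of polynomial columns. -/
def companionCoeffsEquiv (F : Type*) [Field F] (u r s : ℕ) :
    Matrix (Fin u) (Fin (s + 1) × Fin r) F × (Fin (s + 1) → Matrix (Fin r) (Fin r) F) ≃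
      (Fin r → Fin (s + 1) → Fin r ⊕ Fin u → F) where
  toFun p := companionCoeffs p.1 p.2
  invFun g := (Matrix.of fun k p => g p.2 p.1.rev (Sum.inr k),
    fun j => Matrix.of fun c a => -g a j.rev (Sum.inl c))
  left_inv p := by
    refine Prod.ext ?_ ?_
    · ext k p
      simp [companionCoeffs]
    · funext j
      ext c a
      simp [companionCoeffs]
  right_inv g := by
    funext a j k
    rcases k with c | k <;> simp [companionCoeffs]

/-- Fibre over the leading block: the number of lower coefficients is the same for every independent
`L`, so the probability factors. -/
theorem probFullRank_eq {N t : ℕ} (ht : r * (s + 1) ≤ t) :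
    probFullRank F N r (s + 2) t =
      (∏ i ∈ Finset.range r, (1 - (Fintype.card F : ℝ) ^ ((i : ℤ) - N))) *
        ∏ i ∈ Finset.range r, (1 - (Fintype.card F : ℝ) ^ (((i + 1 : ℕ) : ℤ) - N)) := by
  classical
  have hq : (Fintype.card F : ℝ) ≠ 0 := by exact_mod_cast Fintype.card_ne_zero
  rw [probFullRank, uniformProb_eq_card_div]
  simp only [rank_expandedSyndromeMatrix_eq_iff ht]
  let P : (Fin r → Fin N → F) → (Fin r → Fin (s + 1) → Fin N → F) → Prop :=
    fun L g => HasLeftInverse fun a => leadPoly (s + 1) (L a) (g a)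
  have e : {X : Fin (s + 2) → Matrix (Fin N) (Fin r) F //
      LinearIndependent F (fun a k => X 0 k a) ∧ HasLeftInverse fun a =>
        leadPoly (s + 1) (fun k => X 0 k a) fun j k => X j.rev.succ k a} ≃
      Σ L : {L : Fin r → Fin N → F // LinearIndependent F L}, {g // P L.1 g} :=
    ((blocksEquiv F N r s).subtypeEquiv fun X => Iff.rfl :
      _ ≃ {p : (Fin r → Fin N → F) × _ // LinearIndependent F p.1 ∧ P p.1 p.2}).trans
    { toFun := fun p => ⟨⟨p.1.1, p.2.1⟩, ⟨p.1.2, p.2.2⟩⟩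
      invFun := fun p => ⟨(p.1.1, p.2.1), ⟨p.1.2, p.2.2⟩⟩
      left_inv := fun p => rfl
      right_inv := fun p => rfl }
  have hΩ : (Nat.card (Fin (s + 2) → Matrix (Fin N) (Fin r) F) : ℝ) =
      (Fintype.card F : ℝ) ^ ((0 + N) * r) * (Fintype.card F : ℝ) ^ ((s * N + N) * r) := by
    rw [Nat.card_congr (blocksEquiv F N r s)]
    simp only [Nat.card_prod, Nat.card_fun, Nat.card_fin, Nat.card_eq_fintype_card (α := F)]
    push_cast
    simp only [← pow_mul, ← pow_add]
    congr 1
    ring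
  have h2 := prod_sub_pow_eq hq N (s * N) r (fun i => i + 1)
  have h1 := prod_sub_pow_eq hq N 0 r (fun i => i)
  simp only [zero_add] at h1
  rw [Nat.card_congr e, Nat.card_sigma, Nat.cast_sum,
    Finset.sum_congr rfl fun L _ => card_hasLeftInverse_leadPoly L.2,
    Finset.sum_const, nsmul_eq_mul, Finset.card_univ, ← Nat.card_eq_fintype_card,
    card_linearIndependent_columns, hΩ, Nat.card_eq_fintype_card, Fintype.card_fin, h1]
  simp only [add_mul, one_mul, add_assoc] at h2 ⊢
  rw [h2, zero_mul, zero_add]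
  field_simp

/-- `(Z, A)` runs bijectively over all lower coefficients with `r + u` rows, so only the factor for
a fixed leading block remains. -/
theorem probStackedFullRank_eq {u t : ℕ} (ht : r * (s + 1) ≤ t) :
    probStackedFullRank F u r (s + 2) t =
      ∏ i ∈ Finset.range r, (1 - (Fintype.card F : ℝ) ^ (((i + 1 : ℕ) : ℤ) - (r + u : ℕ))) := by
  classical
  have hq : (Fintype.card F : ℝ) ≠ 0 := by exact_mod_cast Fintype.card_ne_zero
  have h0 : probStackedFullRank F u r (s + 2) t =
      uniformProb
        (Matrix (Fin u) (Fin (s + 1) × Fin r) F × (Fin (s + 1) → Matrix (Fin r) (Fin r) F))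
        {ω | (stackedPowers t ω.1 (blockCompanion ω.2)).rank = r * (s + 1)} := rfl
  rw [h0, uniformProb_eq_card_div]
  simp only [rank_stackedPowers_blockCompanion_eq_iff ht]
  have e : {ω : Matrix (Fin u) (Fin (s + 1) × Fin r) F ×
        (Fin (s + 1) → Matrix (Fin r) (Fin r) F) //
      HasLeftInverse fun a => leadPoly (s + 1)
        (Sum.elim (Pi.single a 1) 0 : Fin r ⊕ Fin u → F) (companionCoeffs ω.1 ω.2 a)} ≃
      {g : Fin r → Fin (s + 1) → Fin r ⊕ Fin u → F // HasLeftInverse fun a =>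
        leadPoly (s + 1) (Sum.elim (Pi.single a 1) 0 : Fin r ⊕ Fin u → F) (g a)} :=
    (companionCoeffsEquiv F u r s).subtypeEquiv fun ω => Iff.rfl
  have hΩ : (Nat.card (Matrix (Fin u) (Fin (s + 1) × Fin r) F ×
      (Fin (s + 1) → Matrix (Fin r) (Fin r) F)) : ℝ) =
      (Fintype.card F : ℝ) ^ ((s * (r + u) + (r + u)) * r) := by
    rw [Nat.card_congr (companionCoeffsEquiv F u r s)]
    simp only [Nat.card_fun, Nat.card_sum, Nat.card_fin, Nat.card_eq_fintype_card (α := F)]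
    push_cast
    simp only [← pow_mul]
    congr 1
    ring
  have h2 := prod_sub_pow_eq hq (r + u) (s * (r + u)) r (fun i => i + 1)
  have h3 := card_hasLeftInverse_leadPoly (s := s) (linearIndependent_sumElim_single F u r)
  simp only [Fintype.card_sum, Fintype.card_fin, add_assoc] at h3
  rw [Nat.card_congr e, h3, hΩ, Nat.card_eq_fintype_card]
  rw [Finset.prod_congr rfl fun i _ => by rw [add_one_mul s (r + u)], h2]
  field_simp

end Probability

/-! ### Estimates for the products -/

section Bounds

theorem prod_Icc_one_eq_prod_range (f : ℕ → ℝ) (r : ℕ) :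
    ∏ j ∈ Finset.Icc 1 r, f j = ∏ i ∈ Finset.range r, f (i + 1) := by
  induction r with
  | zero => simp
  | succ r ih => rw [Finset.prod_Icc_succ_top (by omega), ih, Finset.prod_range_succ]

theorem one_sub_sum_le_prod_one_sub {ι : Type*} (s : Finset ι) {a : ι → ℝ}
    (h0 : ∀ i ∈ s, 0 ≤ a i) (h1 : ∀ i ∈ s, a i ≤ 1) :
    1 - ∑ i ∈ s, a i ≤ ∏ i ∈ s, (1 - a i) := by
  classical
  induction s using Finset.induction_on with
  | empty => simp
  | insert i s hi ih =>
    rw [Finset.sum_insert hi, Finset.prod_insert hi]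
    have h0' : ∀ j ∈ s, 0 ≤ a j := fun j hj => h0 j (Finset.mem_insert_of_mem hj)
    have ih := ih h0' fun j hj => h1 j (Finset.mem_insert_of_mem hj)
    have hs := Finset.sum_nonneg h0'
    have hi0 := h0 i (Finset.mem_insert_self i s)
    have hi1 := h1 i (Finset.mem_insert_self i s)
    nlinarith [mul_nonneg hi0 hs, mul_le_mul_of_nonneg_left ih (sub_nonneg.2 hi1)]

variable {q : ℝ}

theorem zpow_nonpos_le_one (hq : 1 < q) {m : ℤ} (hm : m ≤ 0) : q ^ m ≤ 1 := by
  simpa using zpow_le_zpow_right₀ hq.le hm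

theorem prod_one_sub_zpow_eq_zero {N r : ℕ} (h : N < r) :
    ∏ i ∈ Finset.range r, (1 - q ^ ((i : ℤ) - N)) = 0 :=
  Finset.prod_eq_zero (Finset.mem_range.2 h) (by simp)

theorem prod_one_sub_zpow_bounds (hq : 1 < q) {N r : ℕ} (hr : 1 ≤ r) (h : r ≤ N) {c : ℕ}
    (hc : c ≤ 1) :
    0 ≤ ∏ i ∈ Finset.range r, (1 - q ^ (((i + c : ℕ) : ℤ) - N)) ∧
      ∏ i ∈ Finset.range r, (1 - q ^ (((i + c : ℕ) : ℤ) - N)) ≤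
        1 - q ^ (((r - 1 + c : ℕ) : ℤ) - N) := by
  have hq0 : 0 < q := zero_lt_one.trans hq
  have hnn : ∀ i ∈ Finset.range r, 0 ≤ 1 - q ^ (((i + c : ℕ) : ℤ) - N) := fun i hi => by
    have := Finset.mem_range.1 hi
    exact sub_nonneg.2 (zpow_nonpos_le_one hq (by omega))
  refine ⟨Finset.prod_nonneg hnn, ?_⟩
  obtain ⟨r, rfl⟩ : ∃ m, r = m + 1 := ⟨r - 1, by omega⟩
  rw [Finset.prod_range_succ, Nat.add_sub_cancel]
  refine mul_le_of_le_one_left (hnn r (Finset.self_mem_range_succ r)) ?_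
  refine Finset.prod_le_one (fun i hi => hnn i ?_) fun i _ => sub_le_self _ (zpow_pos hq0 _).le
  exact Finset.mem_range.2 ((Finset.mem_range.1 hi).trans (Nat.lt_succ_self r))

/-- Each product is at least 1 minus the sum of its terms, a geometric sum bounded by replacing `q ^
r - 1` with `q ^ r`. The two defects, with numerators 1 and `q` over `q - 1`, add up to the
constant. -/
theorem one_sub_zpow_le_prod_one_sub_zpow (hq : 1 < q) {N r : ℕ} (hr : 1 ≤ r) (h : r ≤ N) :
    1 - (q + 1) / (q - 1) * q ^ ((r : ℤ) - N) ≤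
      (∏ i ∈ Finset.range r, (1 - q ^ ((i : ℤ) - N))) *
        ∏ i ∈ Finset.range r, (1 - q ^ (((i + 1 : ℕ) : ℤ) - N)) := by
  have hq0 : 0 < q := zero_lt_one.trans hq
  have h1 : ∀ c : ℕ, c ≤ 1 → 1 - q ^ ((r : ℤ) - N) * q ^ c / (q - 1) ≤
      ∏ i ∈ Finset.range r, (1 - q ^ (((i + c : ℕ) : ℤ) - N)) := by
    intro c hc
    refine le_trans ?_ (one_sub_sum_le_prod_one_sub _ (fun i _ => (zpow_pos hq0 _).le)
      fun i hi => zpow_nonpos_le_one hq (by have := Finset.mem_range.1 hi; omega))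
    have hsum : ∑ i ∈ Finset.range r, q ^ (((i + c : ℕ) : ℤ) - N) =
        q ^ (-(N : ℤ)) * q ^ c * ((q ^ r - 1) / (q - 1)) := by
      rw [← geom_sum_eq hq.ne', Finset.mul_sum]
      refine Finset.sum_congr rfl fun i _ => ?_
      rw [← zpow_natCast, ← zpow_natCast, ← zpow_add₀ hq0.ne', ← zpow_add₀ hq0.ne']
      congr 1
      push_cast
      ring
    rw [hsum, sub_eq_add_neg (r : ℤ), zpow_add₀ hq0.ne', zpow_natCast]
    refine sub_le_sub_left ?_ _
    rw [← mul_div_assoc]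
    refine div_le_div_of_nonneg_right ?_ (sub_pos.2 hq).le
    have hA : 0 ≤ q ^ (-(N : ℤ)) * q ^ c := by positivity
    nlinarith
  obtain ⟨h00, h01⟩ := prod_one_sub_zpow_bounds hq hr h (c := 0) zero_le_one
  obtain ⟨h10, h11⟩ := prod_one_sub_zpow_bounds hq hr h (c := 1) le_rfl
  have hx0 := h1 0 zero_le_one
  have hx1 := h1 1 le_rfl
  have hle0 := h01.trans (sub_le_self _ (zpow_pos hq0 _).le)
  have hle1 := h11.trans (sub_le_self _ (zpow_pos hq0 _).le)
  simp only [add_zero] at hx0 hle0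
  have hsplit : (q + 1) / (q - 1) * q ^ ((r : ℤ) - N) =
      q ^ ((r : ℤ) - N) * q ^ 0 / (q - 1) + q ^ ((r : ℤ) - N) * q ^ 1 / (q - 1) := by
    ring
  rw [hsplit]
  -- For factors at most 1, `(1 - a) * (1 - b) ≥ 0` gives `a * b ≥ a + b - 1`.
  nlinarith [mul_nonneg (sub_nonneg.2 hle0) (sub_nonneg.2 hle1)]

theorem prod_one_sub_zpow_le (hq : 1 < q) {N r : ℕ} (hr : 1 ≤ r) (h : r ≤ N) :
    (∏ i ∈ Finset.range r, (1 - q ^ ((i : ℤ) - N))) *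
        ∏ i ∈ Finset.range r, (1 - q ^ (((i + 1 : ℕ) : ℤ) - N)) ≤
      (1 - q ^ ((r : ℤ) - N)) * (1 - q ^ ((r : ℤ) - N) / q) := by
  have hq0 : 0 < q := zero_lt_one.trans hq
  obtain ⟨h00, h01⟩ := prod_one_sub_zpow_bounds hq hr h (c := 0) zero_le_one
  obtain ⟨h10, h11⟩ := prod_one_sub_zpow_bounds hq hr h (c := 1) le_rfl
  have e0 : q ^ (((r - 1 + 0 : ℕ) : ℤ) - N) = q ^ ((r : ℤ) - N) / q := by
    rw [div_eq_mul_inv, ← zpow_sub_one₀ hq0.ne']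
    congr 1
    omega
  rw [e0] at h01
  rw [Nat.sub_add_cancel hr] at h11
  rw [mul_comm]
  exact mul_le_mul h11 h01 h00 (h10.trans h11)

theorem qProd_eq_prod_range (n : ℕ) :
    qProd q n = ∏ i ∈ Finset.range n, (1 - q ^ (-((i + 1 : ℕ) : ℤ))) := by
  rw [qProd, prod_Icc_one_eq_prod_range fun i => 1 - q ^ (-(i : ℤ))]

theorem qProd_pos (hq : 1 < q) (n : ℕ) : 0 < qProd q n := by
  rw [qProd_eq_prod_range]
  refine Finset.prod_pos fun i _ => sub_pos.2 ?_
  exact zpow_lt_one_of_neg₀ hq (by omega)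

theorem qProd_antitone (hq : 1 < q) : Antitone (qProd q) := by
  refine antitone_nat_of_succ_le fun n => ?_
  have h := (qProd_pos hq n).le
  rw [qProd_eq_prod_range] at h ⊢
  rw [qProd_eq_prod_range, Finset.prod_range_succ]
  exact mul_le_of_le_one_right h
    (sub_le_self _ (zpow_pos (zero_lt_one.trans hq) _).le)

/-- The right side is exactly `H_q(u + r - 1) / H_q(u - 1)`, with factors in reverse order, and
`H_q` decreases. -/
theorem qProd_div_qProd_le (hq : 1 < q) {u r : ℕ} (hu : 1 ≤ u) {m : ℕ} (hm : r ≤ m) :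
    qProd q (m + u - 1) / qProd q (u - 1) ≤
      ∏ i ∈ Finset.range r, (1 - q ^ (((i + 1 : ℕ) : ℤ) - (r + u : ℕ))) := by
  rw [div_le_iff₀ (qProd_pos hq _)]
  refine (qProd_antitone hq (show u - 1 + r ≤ m + u - 1 by omega)).trans (le_of_eq ?_)
  rw [qProd_eq_prod_range, qProd_eq_prod_range, Finset.prod_range_add, mul_comm]
  congr 1
  rw [← Finset.prod_range_reflect]
  refine Finset.prod_congr rfl fun i hi => ?_
  have := Finset.mem_range.1 hi
  congr 2
  omega

end Bounds

/-! ### The main theorem -/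

theorem theorem4 {F : Type*} [Field F] [Fintype F] (q : ℕ) (hq : Fintype.card F = q)
    (n k r d : ℕ) (hk : k ≤ n) (hr : 1 ≤ r) (hd : 2 ≤ d)
    (u : ℤ) (hu : u = (n : ℤ) - k - r) :
    -- the exact value of `P_t` for `t = r (d - 1)`
    probFullRank F (n - k) r d (r * (d - 1)) =
        (∏ j ∈ Finset.range r, (1 - (q : ℝ) ^ ((j : ℤ) - ((n : ℤ) - k)))) *
          ∏ j ∈ Finset.Icc 1 r, (1 - (q : ℝ) ^ ((j : ℤ) - ((n : ℤ) - k))) ∧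
    -- the two bounds on `P_t`
    1 - ((q : ℝ) + 1) / ((q : ℝ) - 1) * (q : ℝ) ^ (-u) ≤
        probFullRank F (n - k) r d (r * (d - 1)) ∧
    probFullRank F (n - k) r d (r * (d - 1)) ≤
        1 - ((q : ℝ) + 1) / (q : ℝ) * (q : ℝ) ^ (-u) + (q : ℝ) ^ (-2 * u - 1) ∧
    -- the exact value of `Q_t` for `t = r (d - 1)` and its upper bound
    (r ≤ n - k →
      probStackedFullRank F (n - k - r) r d (r * (d - 1)) =
          ∏ j ∈ Finset.Icc 1 r, (1 - (q : ℝ) ^ ((j : ℤ) - ((n : ℤ) - k))) ∧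
      probStackedFullRank F (n - k - r) r d (r * (d - 1)) ≤ 1 - (q : ℝ) ^ (-u)) ∧
    -- the lower bound on `Q_t`, where `u ≥ 1`
    (r < n - k →
      qProd q ((d - 1) * r + (n - k - r) - 1) / qProd q (n - k - r - 1) ≤
        probStackedFullRank F (n - k - r) r d (r * (d - 1))) := by
  obtain ⟨s, rfl⟩ : ∃ s, d = s + 2 := ⟨d - 2, by omega⟩
  obtain ⟨N, rfl⟩ : ∃ N, n = k + N := ⟨n - k, by omega⟩
  have hNz : ((k + N : ℕ) : ℤ) - k = N := by push_cast; ring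
  have hN : k + N - k = N := by omega
  have hs : s + 2 - 1 = s + 1 := rfl
  have hq1 : (1 : ℝ) < q := by
    rw [← hq]
    exact_mod_cast Fintype.one_lt_card
  have hq0 : (0 : ℝ) < q := zero_lt_one.trans hq1
  have hu' : -u = (r : ℤ) - N := by rw [hu, hNz]; ring
  have hP : probFullRank F N r (s + 2) (r * (s + 1)) =
      (∏ i ∈ Finset.range r, (1 - (q : ℝ) ^ ((i : ℤ) - N))) *
        ∏ i ∈ Finset.range r, (1 - (q : ℝ) ^ (((i + 1 : ℕ) : ℤ) - N)) := by
    rw [probFullRank_eq le_rfl, hq]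
  rw [hN, hNz, hs, hu', show -2 * u - 1 = ((r : ℤ) - N) + ((r : ℤ) - N) - 1 by omega,
    prod_Icc_one_eq_prod_range fun j => 1 - (q : ℝ) ^ ((j : ℤ) - (N : ℤ)), hP]
  -- The upper bound is `(1 - x) * (1 - x / q)` with `x = q ^ (-u)`, the product of the last factors
  -- of the two products.
  have hupper : 1 - ((q : ℝ) + 1) / q * (q : ℝ) ^ ((r : ℤ) - N) +
      (q : ℝ) ^ ((r : ℤ) - N + ((r : ℤ) - N) - 1) =
      (1 - (q : ℝ) ^ ((r : ℤ) - N)) * (1 - (q : ℝ) ^ ((r : ℤ) - N) / q) := by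
    rw [zpow_sub_one₀ hq0.ne', zpow_add₀ hq0.ne']
    field_simp
    ring
  have hQ : r ≤ N → probStackedFullRank F (N - r) r (s + 2) (r * (s + 1)) =
      ∏ i ∈ Finset.range r, (1 - (q : ℝ) ^ (((i + 1 : ℕ) : ℤ) - N)) := fun h => by
    rw [probStackedFullRank_eq le_rfl, hq, Nat.add_sub_cancel' h]
  refine ⟨rfl, ?_, ?_, fun h => ?_, fun h => ?_⟩
  · rcases le_or_gt r N with h | h
    · exact one_sub_zpow_le_prod_one_sub_zpow hq1 hr h
    · rw [prod_one_sub_zpow_eq_zero h, zero_mul, sub_nonpos]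
      have h1 : (1 : ℝ) ≤ (q + 1) / (q - 1) := by
        rw [one_le_div (by linarith)]
        linarith
      exact one_le_mul_of_one_le_of_one_le h1 (one_le_zpow₀ hq1.le (by omega))
  · rw [hupper]
    rcases le_or_gt r N with h | h
    · exact prod_one_sub_zpow_le hq1 hr h
    -- For `u < 0` the probability is 0, and both factors of the bound are nonpositive because `x /
    -- q = q ^ (-u - 1) ≥ 1`.
    · rw [prod_one_sub_zpow_eq_zero h, zero_mul]
      refine mul_nonneg_of_nonpos_of_nonpos
        (sub_nonpos.2 (one_le_zpow₀ hq1.le (by omega))) (sub_nonpos.2 ?_)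
      rw [div_eq_mul_inv, ← zpow_sub_one₀ hq0.ne']
      exact one_le_zpow₀ hq1.le (by omega)
  · refine ⟨hQ h, ?_⟩
    rw [hQ h]
    have := (prod_one_sub_zpow_bounds hq1 hr h (c := 1) le_rfl).2
    rwa [Nat.sub_add_cancel hr] at this
  · rw [hQ h.le]
    have := qProd_div_qProd_le hq1 (u := N - r) (r := r) (by omega)
      (m := (s + 1) * r) (Nat.le_mul_of_pos_left r (Nat.succ_pos s))
    rwa [Nat.add_sub_cancel' h.le] at this
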